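/- Let $G,H$ be $\sigma$-compact locally compact (Hausdorff) abelian groups with Haar measures $m_G,m_H$, and let $\widetilde L\subset G\times H$ be a lattice (a discrete cocompact subgroup) such that the projection $G\times H\to G$ is one-to-one on $\widetilde L$ and the projection of $\widetilde L$ to $H$ is dense in $H$. Let $\mathbb T:=(G\times H)/\widetilde L$, with quotient map $(s,k)\mapsto[s,k]$, and let $\rho$ be an $\widetilde L$-invariant complex Radon measure on $G\times H$ (not necessarily finite), with total variation $|\rho|$. For an $\widetilde L$-invariant complex Radon measure $\sigma$ on $G\times H$ there is a unique complex measure $\sigma_{\mathbb T}$ on $\mathbb T$ with $$\int_{G\times H} g\,d\sigma=\int_{\mathbb T}\sum_{x\in\xi}g(x)\,d\sigma_{\mathbb T}(\xi)\qquad\text{for all } g\in C_c(G\times H);$$ this is applied to $\sigma=\rho$ and to $\sigma=m_G\times m_H$, and $(m_G\times m_H)_{\mathbb T}(1)\neq0$. A function $f:H\to\mathbb C$ is called admissible if it is Borel measurable, locally bounded, and for all $\varepsilon>0$ and $\varphi\in C_c(G)$ there is a compact $Q\subset H$ with $$\int_{G\times H}|\varphi(t+s)f(h+k)|\,(1-1_Q(h+k))\,d|\rho|(t,h)\le\varepsilon\qquad\text{for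 all }(s,k)\in G\times H.$$ A function $f:H\to\mathbb R$ is called Riemann integrable if for every $\varepsilon>0$ there are real $\varphi,\psi\in C_c(H)$ with $\varphi\le f\le\psi$ and $\int_H(\psi-\varphi)\,dm_H\le\varepsilon$. A van Hove sequence in $G$ is a sequence $(B_n)$ of relatively compact Borel sets of positive measure with $m_G(\partial^KB_n)/m_G(B_n)\to0$ for every compact $K\subset G$, where $\partial^KA:=((K+A)\setminus A^\circ)\cup((-K+\overline{G\setminus A})\cap A)$. Assume that one of the following holds: (1) $f\in C_c(H)$ (complex-valued); (2) $f:H\to\mathbb C$ is continuous and admissible; (3) $\rho\ge0$, and $f:H\to\mathbb R$ is Riemann integrable and such that $(t,h)\mapsto f(h+k)$ is $\rho$-measurable for every $k\in H$ (for instance, $f$ is Borel). Then $f$ is $m_H$-integrable (in case (2) provided that $\rho\ne0$). Moreover, for every van Hove sequence $(B_n)$ in $G$ the integrals $$\mu(\xi)(\chi_{B_n}):=\int_{G\times H}f(h+k)\,\chi_{B_n}(t+s)\,d\rho(t,h),\qquad \xi=[s,k]\in\mathbb T,$$ exist and depend only on $\xi$, and $$\lim_{n\to\infty}\frac{1}{m_G(B_n)}\,\mu(\xi)(\chi_{B_n})=\frac{\rho_{\mathbb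 T}(1)}{(m_G\times m_H)_{\mathbb T}(1)}\int_Hf\,dm_H$$ uniformly in $\xi\in\mathbb T$. (If $\rho=0$, both sides are read as $0$.) -/

import Mathlib

open MeasureTheory Filter Topology Set
open scoped Pointwise CompactlySupported

/-- A complex Radon measure `ρ` on a (σ-compact) locally compact Hausdorff space, in polar form
`ρ = phase · |ρ|`: its total variation `|ρ|` is a positive regular Borel measure, finite on compact
sets but possibly of infinite total mass, and `phase` is a Borel function of modulus one.
These are the locally bounded linear functionals on `C_c(X, ℂ)`.
The σ-algebra is the Borel σ-algebra of `X`; for a product of spaces that are not second countable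
it may be larger than the product σ-algebra. -/
structure ComplexRadonMeasure (X : Type*) [TopologicalSpace X] where
  variation : @Measure X (borel X)
  regular : @Measure.Regular X (borel X) _ variation
  phase : X → ℂ
  measurable_phase : @Measurable X ℂ (borel X) _ phase
  norm_phase : ∀ x, ‖phase x‖ = 1

namespace ComplexRadonMeasure

variable {X : Type*} [TopologicalSpace X]

/-- `F` is integrable with respect to `ρ`, that is, with respect to `|ρ|`. -/
def IntegrableFun (ρ : ComplexRadonMeasure X) (F : X → ℂ) : Prop :=
  Integrable F ρ.variation

/-- `ρ(F) = ∫ F dρ`. -/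
noncomputable def integral (ρ : ComplexRadonMeasure X) (F : X → ℂ) : ℂ :=
  @MeasureTheory.integral X ℂ _ _ (borel X) ρ.variation (fun x => F x * ρ.phase x)

/-- `ρ` is invariant under translations by elements of the subgroup `L`. -/
def IsInvariant [AddGroup X] (ρ : ComplexRadonMeasure X) (L : AddSubgroup X) : Prop :=
  ∀ l ∈ L, ∀ g : C_c(X, ℂ), ρ.integral (fun x => g (x + l)) = ρ.integral g

/-- `ρ ≥ 0`, that is, `ρ = |ρ|`. -/
def IsPositive (ρ : ComplexRadonMeasure X) : Prop :=
  ∀ᵐ x ∂ρ.variation, ρ.phase x = 1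

end ComplexRadonMeasure

/-- A cut and project scheme: `lattice` is a discrete cocompact subgroup of `G × H` on which the
projection to `G` is one-to-one and whose projection to `H` is dense. -/
structure CutProjectScheme (G H : Type*) [AddCommGroup G] [TopologicalSpace G]
    [AddCommGroup H] [TopologicalSpace H] where
  lattice : AddSubgroup (G × H)
  discrete : DiscreteTopology lattice
  cocompact : CompactSpace ((G × H) ⧸ lattice)
  injOn_fst : Set.InjOn (Prod.fst : G × H → G) (lattice : Set (G × H))
  dense_snd : Dense ((Prod.snd : G × H → H) '' (lattice : Set (G × H)))

namespace CutProjectScheme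

variable {G H : Type*} [AddCommGroup G] [TopologicalSpace G] [AddCommGroup H] [TopologicalSpace H]

/-- The compact group `𝕋 = (G × H) / lattice`. -/
abbrev Torus (S : CutProjectScheme G H) : Type _ := (G × H) ⧸ S.lattice

/-- `σ_ξ(g)`: the sum of `g` over the coset `ξ`. -/
noncomputable def cosetSum (S : CutProjectScheme G H) (g : C_c(G × H, ℂ)) (ξ : S.Torus) : ℂ :=
  ∑' y : {y : G × H // (QuotientAddGroup.mk y : S.Torus) = ξ}, g y

theorem cosetSum_mk (S : CutProjectScheme G H) (g : C_c(G × H, ℂ)) (x : G × H) :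
    S.cosetSum g (QuotientAddGroup.mk x) = ∑' l : S.lattice, g (x + l) := by
  let e : S.lattice ≃
      {y : G × H // (QuotientAddGroup.mk y : S.Torus) = QuotientAddGroup.mk x} :=
    { toFun := fun l => ⟨x + l, by simp⟩
      invFun := fun y => ⟨-x + y, QuotientAddGroup.eq.1 y.2.symm⟩
      left_inv := fun l => by ext <;> simp
      right_inv := fun y => by ext <;> simp }
  exact (e.tsum_eq (fun y => g (y : G × H))).symm

theorem continuous_cosetSum [IsTopologicalAddGroup G] [LocallyCompactSpace G] [T2Space G]
    [IsTopologicalAddGroup H] [LocallyCompactSpace H] [T2Space H]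
    (S : CutProjectScheme G H) (g : C_c(G × H, ℂ)) : Continuous (S.cosetSum g) := by
  have := S.discrete
  have key : ∀ K : Set (G × H), IsCompact K →
      {l : S.lattice | ∃ x ∈ K, g (x + l) ≠ 0}.Finite := by
    intro K hK
    have hc : IsCompact (tsupport g - K) :=
      sub_eq_add_neg (tsupport g) K ▸ g.hasCompactSupport.isCompact.add hK.neg
    have ht := AddSubgroup.tendsto_coe_cofinite_of_discrete S.lattice ⟨S.discrete⟩
    have hf : {l : S.lattice | (l : G × H) ∈ tsupport g - K}.Finite := by
      have h := ht hc.compl_mem_cocompact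
      rw [mem_map, mem_cofinite] at h
      refine h.subset fun l hl => ?_
      simpa using hl
    refine hf.subset ?_
    rintro l ⟨x, hx, hl⟩
    exact ⟨x + l, subset_tsupport _ hl, x, hx, by simp⟩
  refine (QuotientAddGroup.isQuotientMap_mk (N := S.lattice)).continuous_iff.2 ?_
  have heq : S.cosetSum g ∘ (QuotientAddGroup.mk : G × H → S.Torus) =
      fun x => ∑ᶠ l : S.lattice, g (x + l) := by
    funext x
    rw [Function.comp_apply, cosetSum_mk, tsum_eq_finsum]
    exact (key {x} isCompact_singleton).subset fun l hl => ⟨x, rfl, hl⟩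
  rw [heq]
  refine continuous_finsum (fun l => g.continuous.comp (continuous_id.add continuous_const)) ?_
  intro x
  obtain ⟨K, hK, hx⟩ := exists_compact_mem_nhds x
  exact ⟨K, hx, (key K hK).subset fun l ⟨y, hy, hyK⟩ => ⟨y, hyK, hy⟩⟩

/-- The continuous function `ξ ↦ σ_ξ(g)` on `𝕋`. -/
noncomputable def cosetSumMap [IsTopologicalAddGroup G] [LocallyCompactSpace G] [T2Space G]
    [IsTopologicalAddGroup H] [LocallyCompactSpace H] [T2Space H]
    (S : CutProjectScheme G H) (g : C_c(G × H, ℂ)) : C(S.Torus, ℂ) :=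
  ⟨S.cosetSum g, S.continuous_cosetSum g⟩

/-- The complex measure `J` on the compact group `𝕋` (a continuous linear functional on `C(𝕋)`)
disintegrates the functional `I` on `C_c(G × H)`: one has `I(g) = ∫_𝕋 σ_ξ(g) dJ(ξ)` for all `g`.
For `I = ρ` it is the measure denoted `ρ_𝕋`. -/
def IsDisintegration [IsTopologicalAddGroup G] [LocallyCompactSpace G] [T2Space G]
    [IsTopologicalAddGroup H] [LocallyCompactSpace H] [T2Space H]
    (S : CutProjectScheme G H) (I : C_c(G × H, ℂ) → ℂ) (J : C(S.Torus, ℂ) →L[ℂ] ℂ) : Prop :=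
  ∀ g : C_c(G × H, ℂ), I g = J (S.cosetSumMap g)

end CutProjectScheme

section Weyl

variable {G H : Type*} [AddCommGroup G] [TopologicalSpace G] [AddCommGroup H] [TopologicalSpace H]

/-- The functional `g ↦ ∫ g d(m_G × m_H)` on `C_c(G × H)`. -/
noncomputable def prodFunctional [MeasurableSpace G] [MeasurableSpace H]
    (mG : Measure G) (mH : Measure H) (g : C_c(G × H, ℂ)) : ℂ :=
  ∫ t, ∫ h, g (t, h) ∂mH ∂mG

/-- The `K`-boundary `∂^K A = ((K + A) \ A°) ∪ ((-K + closure (G \ A)) ∩ A)`. -/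
def vanHoveBoundary (K A : Set G) : Set G :=
  ((K + A) \ interior A) ∪ ((-K + closure Aᶜ) ∩ A)

/-- A van Hove sequence: relatively compact Borel sets of positive measure with
`m_G(∂^K B_n) / m_G(B_n) → 0` for every compact `K`. -/
structure IsVanHove [MeasurableSpace G] (mG : Measure G) (B : ℕ → Set G) : Prop where
  measurableSet : ∀ n, MeasurableSet (B n)
  relCompact : ∀ n, IsCompact (closure (B n))
  pos : ∀ n, 0 < mG (B n)
  boundary : ∀ K : Set G, IsCompact K →
    Tendsto (fun n => mG (vanHoveBoundary K (B n)) / mG (B n)) atTop (𝓝 0)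

/-- Admissibility of `f : H → ℂ` with respect to `ρ`. -/
structure IsAdmissible [MeasurableSpace H] (ρ : ComplexRadonMeasure (G × H)) (f : H → ℂ) :
    Prop where
  measurable : Measurable f
  locallyBounded : ∀ h, ∃ U ∈ 𝓝 h, ∃ C : ℝ, ∀ x ∈ U, ‖f x‖ ≤ C
  tight : ∀ ε : ℝ, 0 < ε → ∀ φ : C_c(G, ℂ), ∃ Q : Set H, IsCompact Q ∧ ∀ (s : G) (k : H),
    @lintegral (G × H) (borel (G × H)) ρ.variation
      (fun x => ‖φ (x.1 + s) * f (x.2 + k)‖ₑ * Qᶜ.indicator 1 (x.2 + k)) ≤ ENNReal.ofReal ε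

/-- Riemann integrability of `f : H → ℝ`: sandwiched between functions in `C_c(H)` whose
integrals are arbitrarily close. -/
def IsRiemannIntegrable [MeasurableSpace H] (mH : Measure H) (f : H → ℝ) : Prop :=
  ∀ ε : ℝ, 0 < ε → ∃ φ ψ : C_c(H, ℝ), (∀ h, φ h ≤ f h ∧ f h ≤ ψ h) ∧
    ∫ h, (ψ h - φ h) ∂mH ≤ ε

/-- The integrand `(t, h) ↦ f(h + k) χ_B(t + s)` of `μ([s, k])(χ_B)`, for `x = (s, k)`. -/
noncomputable def muIntegrand (f : H → ℂ) (B : Set G) (x : G × H) : G × H → ℂ :=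
  fun y => f (y.2 + x.2) * B.indicator 1 (y.1 + x.1)

/-- For every van Hove sequence `(B_n)` the numbers
`μ([s, k])(χ_{B_n}) = ∫ f(h + k) χ_{B_n}(t + s) dρ(t, h)` exist, depend on `ξ = [s, k] ∈ 𝕋` only,
and `μ(ξ)(χ_{B_n}) / m_G(B_n)` converges to `c` uniformly in `ξ ∈ 𝕋`. -/
def WeylConvergence [MeasurableSpace G] (mG : Measure G) (S : CutProjectScheme G H)
    (ρ : ComplexRadonMeasure (G × H)) (f : H → ℂ) (c : ℂ) : Prop :=
  ∀ B : ℕ → Set G, IsVanHove mG B →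
    (∀ n x, ρ.IntegrableFun (muIntegrand f (B n) x)) ∧
    ∃ μ : ℕ → S.Torus → ℂ,
      (∀ n (x : G × H), μ n (QuotientAddGroup.mk x) = ρ.integral (muIntegrand f (B n) x)) ∧
      TendstoUniformly (fun n ξ => μ n ξ / (mG.real (B n) : ℂ)) (fun _ => c) atTop

end Weyl

/-! For `f ∈ C_c(H)`, replace `χ_{B_n}` by a continuous cutoff `u_n` and put `g_n = u_n ⊗ f`. The
integral of `g_n(· + x)` against `ρ` is `ρ_𝕋` applied to a translate of the coset sum `F_n =
σ(g_n)`. So it suffices that `F_n / m_G(B_n)` tends uniformly on `𝕋` to a constant; uniformity in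
`ξ` is then automatic, because translating does not increase the sup norm.

`F_n` is almost constant because the lattice projects densely to `H`: any two points of `𝕋` differ
by some `[c, v]` with `v` in a prescribed neighbourhood of `0` and `c` in a compact set
(`exists_compact_strip`). Moving by `v` hardly changes `f`; moving by `c` changes `u_n` only in a
van Hove boundary layer (`eventually_osc_le`). Integrating `F_n` against Haar measure identifies the
constant as `∫ f dm_H / m_𝕋(1)`. Passing from `u_n` back to `χ_{B_n}` costs a boundary layer again,
negligible because `|ρ|` is translation bounded. This gives `eventually_norm_integral_sub_le`.

Other `f` are reached by approximation with `C_c(H)`, in `L¹(m_H)` and in `|ρ|`-mean over strips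
(`weylConvergence_of_approx`). For an admissible `f` the approximant is a truncation `f θ`: a
covering argument bounds the error on strips (`lintegral_strip_le`), and averaging the admissibility
estimate over `𝕋` bounds the tail of `∫ |f| dm_H` (`lintegral_tail_le`). For a Riemann integrable
`f` the error is at most `ψ - φ ∈ C_c(H)`, and as `ρ ≥ 0` the `C_c(H)` case controls it. -/

set_option linter.unusedSectionVars false

open CompactlySupportedContinuousMap

/-! ### Operations on compactly supported continuous functions -/

section CompactlySupported

variable {X E : Type*} [TopologicalSpace X]

namespace CompactlySupportedContinuousMap

/-- The translate `y ↦ g (y + x)`. -/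
def transl [AddGroup X] [IsTopologicalAddGroup X] [Zero E] [TopologicalSpace E]
    (g : C_c(X, E)) (x : X) : C_c(X, E) :=
  ⟨⟨fun y => g (y + x), g.continuous.comp (continuous_add_const x)⟩,
    g.hasCompactSupport.comp_homeomorph (Homeomorph.addRight x)⟩

@[simp]
theorem transl_apply [AddGroup X] [IsTopologicalAddGroup X] [Zero E] [TopologicalSpace E]
    (g : C_c(X, E)) (x y : X) : g.transl x y = g (y + x) := rfl

/-- A real compactly supported continuous function, regarded as a complex one. -/
noncomputable def toComplex (g : C_c(X, ℝ)) : C_c(X, ℂ) :=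
  ⟨⟨fun y => (g y : ℂ), Complex.continuous_ofReal.comp g.continuous⟩,
    g.hasCompactSupport.comp_left Complex.ofReal_zero⟩

@[simp]
theorem toComplex_apply (g : C_c(X, ℝ)) (y : X) : g.toComplex y = (g y : ℂ) := rfl

/-- The tensor product `(t, h) ↦ φ t * f h`. -/
noncomputable def tensor {G H : Type*} [TopologicalSpace G] [TopologicalSpace H]
    [T2Space G] [T2Space H] (φ : C_c(G, ℂ)) (f : C_c(H, ℂ)) : C_c(G × H, ℂ) :=
  ⟨⟨fun y => φ y.1 * f y.2, (φ.continuous.comp continuous_fst).mul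
      (f.continuous.comp continuous_snd)⟩, by
    refine HasCompactSupport.of_support_subset_isCompact
      (φ.hasCompactSupport.isCompact.prod f.hasCompactSupport.isCompact) ?_
    intro y hy
    exact ⟨subset_tsupport _ (left_ne_zero_of_mul hy), subset_tsupport _ (right_ne_zero_of_mul hy)⟩⟩

@[simp]
theorem tensor_apply {G H : Type*} [TopologicalSpace G] [TopologicalSpace H]
    [T2Space G] [T2Space H] (φ : C_c(G, ℂ)) (f : C_c(H, ℂ)) (y : G × H) :
    φ.tensor f y = φ y.1 * f y.2 := rfl

/-- The product of a continuous function with a compactly supported one. -/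
noncomputable def cmul (F : C(X, ℂ)) (g : C_c(X, ℂ)) : C_c(X, ℂ) :=
  ⟨⟨fun y => F y * g y, F.continuous.mul g.continuous⟩, g.hasCompactSupport.mul_left⟩

@[simp]
theorem cmul_apply (F : C(X, ℂ)) (g : C_c(X, ℂ)) (y : X) : cmul F g y = F y * g y := rfl

theorem exists_norm_le {E : Type*} [NormedAddCommGroup E] (g : C_c(X, E)) :
    ∃ C : ℝ, 0 < C ∧ ∀ x, ‖g x‖ ≤ C := by
  obtain ⟨C, hC⟩ := g.hasCompactSupport.exists_bound_of_continuous g.continuous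
  exact ⟨max C 1, by positivity, fun x => (hC x).trans (le_max_left _ _)⟩

end CompactlySupportedContinuousMap

theorem exists_cutoff [LocallyCompactSpace X] [T2Space X] {K U : Set X} (hK : IsCompact K)
    (hU : IsOpen U) (hKU : K ⊆ U) :
    ∃ θ : C_c(X, ℝ), (∀ x ∈ K, θ x = 1) ∧ (∀ x, x ∉ U → θ x = 0) ∧ (∀ x, 0 ≤ θ x) ∧
      ∀ x, θ x ≤ 1 := by
  obtain ⟨f, h1, h0, hc, hI⟩ := exists_continuous_one_zero_of_isCompact hK hU.isClosed_compl
    (disjoint_compl_right_iff_subset.2 hKU)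
  exact ⟨⟨f, hc⟩, fun x hx => h1 hx, fun x hx => h0 hx, fun x => (hI x).1, fun x => (hI x).2⟩

end CompactlySupported

/-! ### Covering a set in `G` by few translates of a compact set -/

section Covering

theorem Continuous.measurable_of_borel {X Y : Type*} [TopologicalSpace X] [TopologicalSpace Y]
    [MeasurableSpace Y] [BorelSpace Y] {f : X → Y} (hf : Continuous f) : Measurable[borel X] f := by
  let _ := borel X
  have : BorelSpace X := ⟨rfl⟩
  exact hf.measurable

variable {G H : Type*} [AddCommGroup G] [TopologicalSpace G] [IsTopologicalAddGroup G] [T2Space G]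
  [MeasurableSpace G] [BorelSpace G]

/-- Take a maximal family of disjoint translates `a + K` with `a ∈ A`. They all lie in `A + K`,
which bounds their number, and by maximality every further translate meets one of them. -/
theorem exists_finset_cover (mG : Measure G) [mG.IsAddLeftInvariant] {K A : Set G}
    (hK : IsCompact K) (hK0 : mG K ≠ 0) (hA : mG (A + K) ≠ ⊤) :
    ∃ F : Finset G, (F.card : ENNReal) * mG K ≤ mG (A + K) ∧
      ∀ a ∈ A, ∃ b ∈ F, a - b ∈ K - K := by
  classical
  let P : Finset G → Prop := fun F => (F : Set G) ⊆ A ∧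
    (F : Set G).PairwiseDisjoint fun a => (fun z => a + z) '' K
  have hcard : ∀ F, P F → (F.card : ENNReal) * mG K ≤ mG (A + K) := by
    intro F hF
    have h1 : mG (⋃ a ∈ F, (fun z => a + z) '' K) = ∑ a ∈ F, mG ((fun z => a + z) '' K) :=
      measure_biUnion_finset hF.2 fun a _ =>
        (hK.image (continuous_const_add a)).isClosed.measurableSet
    have h2 : ∀ a ∈ F, mG ((fun z => a + z) '' K) = mG K := fun a _ => by simp
    rw [Finset.sum_congr rfl h2, Finset.sum_const, nsmul_eq_mul] at h1
    rw [← h1]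
    refine measure_mono (iUnion₂_subset fun a ha => ?_)
    rintro _ ⟨z, hz, rfl⟩
    exact ⟨a, hF.1 ha, z, hz, rfl⟩
  let N : Set ℕ := {n | ∃ F, P F ∧ F.card = n}
  have hne : N.Nonempty := ⟨0, ∅, ⟨by simp, by simp⟩, rfl⟩
  have hbdd : BddAbove N := by
    obtain ⟨n, hn⟩ := ENNReal.exists_nat_gt (ENNReal.div_ne_top hA hK0)
    refine ⟨n, ?_⟩
    rintro _ ⟨F, hF, rfl⟩
    have h := hcard F hF
    have := ENNReal.le_div_iff_mul_le (Or.inl hK0) (Or.inr hA) |>.2 h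
    exact_mod_cast (this.trans hn.le)
  obtain ⟨F, hF, hFc⟩ := Nat.sSup_mem hne hbdd
  refine ⟨F, hcard F hF, fun a ha => ?_⟩
  by_contra! hcon
  have hKn : K.Nonempty := nonempty_iff_ne_empty.2 fun h => hK0 (by simp [h])
  have haF : a ∉ F := fun h => hcon a h (by
    obtain ⟨z, hz⟩ := hKn
    exact ⟨z, hz, z, hz, by simp⟩)
  have hdis : ∀ b ∈ F, Disjoint ((fun z => a + z) '' K) ((fun z => b + z) '' K) := by
    intro b hb
    rw [Set.disjoint_left]
    rintro _ ⟨z, hz, rfl⟩ ⟨z', hz', h⟩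
    refine hcon b hb ⟨z', hz', z, hz, ?_⟩
    simp only at h ⊢
    rw [sub_eq_sub_iff_add_eq_add, add_comm z', h, add_comm]
  have hP : P (insert a F) := by
    refine ⟨?_, ?_⟩
    · rw [Finset.coe_insert]
      exact insert_subset ha hF.1
    · rw [Finset.coe_insert]
      exact hF.2.insert fun b hb _ => hdis b hb
  have := le_csSup hbdd ⟨insert a F, hP, rfl⟩
  rw [Finset.card_insert_of_notMem haF, hFc] at this
  omega

variable [AddCommGroup H] [TopologicalSpace H] [IsTopologicalAddGroup H]
  [MeasurableSpace H] [BorelSpace H]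

/-- A bound for integrals over translates of a fixed strip `φ ≥ 1_{K - K}` gives a bound for
integrals over an arbitrary strip, proportional to the measure of its base. -/
theorem lintegral_strip_le (mG : Measure G) [mG.IsAddLeftInvariant] {K : Set G}
    (hK : IsCompact K) (hK0 : mG K ≠ 0) {v : @Measure (G × H) (borel (G × H))}
    {φ : G → ENNReal} (hφ : Measurable φ) (hφK : ∀ t ∈ K - K, 1 ≤ φ t)
    {q : H → ENNReal} (hq : Measurable q) {M : ENNReal}
    (hM : ∀ x : G × H, ∫⁻ y, φ (y.1 + x.1) * q (y.2 + x.2) ∂v ≤ M)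
    {A : Set G} (hA : mG (A + K) ≠ ⊤) (x : G × H) :
    (∫⁻ y, A.indicator 1 (y.1 + x.1) * q (y.2 + x.2) ∂v) * mG K ≤ M * mG (A + K) := by
  obtain ⟨F, hF, hcov⟩ := exists_finset_cover mG hK hK0 hA
  have h1 : ∫⁻ y, A.indicator 1 (y.1 + x.1) * q (y.2 + x.2) ∂v ≤
      ∫⁻ y, ∑ b ∈ F, φ (y.1 + (x.1 - b)) * q (y.2 + x.2) ∂v := by
    refine lintegral_mono fun y => ?_
    by_cases hy : y.1 + x.1 ∈ A
    · obtain ⟨b, hb, hbK⟩ := hcov _ hy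
      rw [indicator_of_mem hy, Pi.one_apply, one_mul]
      refine le_trans ?_ (Finset.single_le_sum (f := fun b => φ (y.1 + (x.1 - b)) * q (y.2 + x.2))
        (fun _ _ => zero_le) hb)
      rw [← add_sub_assoc]
      exact le_mul_of_one_le_left zero_le (hφK _ hbK)
    · simp [hy]
  have h2 : ∫⁻ y, ∑ b ∈ F, φ (y.1 + (x.1 - b)) * q (y.2 + x.2) ∂v =
      ∑ b ∈ F, ∫⁻ y, φ (y.1 + (x.1 - b)) * q (y.2 + x.2) ∂v := by
    refine lintegral_finsetSum _ fun b _ => ?_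
    refine Measurable.mul ?_ ?_
    · exact hφ.comp (continuous_fst.add continuous_const).measurable_of_borel
    · exact hq.comp (continuous_snd.add continuous_const).measurable_of_borel
  have h3 : ∑ b ∈ F, ∫⁻ y, φ (y.1 + (x.1 - b)) * q (y.2 + x.2) ∂v ≤ F.card * M := by
    refine (Finset.sum_le_card_nsmul _ _ M fun b _ => hM (x.1 - b, x.2)).trans ?_
    rw [nsmul_eq_mul]
  calc _ ≤ (F.card * M) * mG K := by gcongr; exact h1.trans (h2.le.trans h3)
    _ = M * (F.card * mG K) := by ring
    _ ≤ _ := by gcongr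

end Covering

/-! ### Van Hove sequences -/

section VanHove

variable {G : Type*} [AddCommGroup G] [TopologicalSpace G]

/-- Boundary layers arise below as the points that are `E`-close both to `B` and to its complement.
Symmetry of `E` absorbs the sign in the definition of `∂^E B`. -/
theorem mem_vanHoveBoundary {E B : Set G} (hE : -E = E) {z : G} (h1 : z ∈ B + E)
    (h2 : z ∈ Bᶜ + E) : z ∈ vanHoveBoundary E B := by
  by_cases hz : z ∈ interior B
  · refine Or.inr ⟨?_, interior_subset hz⟩
    rw [hE, add_comm]
    exact add_subset_add_right subset_closure h2
  · exact Or.inl ⟨add_comm B E ▸ h1, hz⟩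

variable [MeasurableSpace G] {mG : Measure G} {B : ℕ → Set G}

theorem IsVanHove.measure_ne_top [IsFiniteMeasureOnCompacts mG] (hB : IsVanHove mG B) (n : ℕ) :
    mG (B n) ≠ ⊤ :=
  ne_top_of_le_ne_top (hB.relCompact n).measure_ne_top (measure_mono subset_closure)

theorem IsVanHove.measure_add_ne_top [IsTopologicalAddGroup G] [IsFiniteMeasureOnCompacts mG]
    (hB : IsVanHove mG B) {E : Set G} (hE : IsCompact E) (n : ℕ) : mG (B n + E) ≠ ⊤ :=
  ne_top_of_le_ne_top ((hB.relCompact n).add hE).measure_ne_top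
    (measure_mono (add_subset_add_right subset_closure))

theorem IsVanHove.eventually_boundary_le [IsFiniteMeasureOnCompacts mG] (hB : IsVanHove mG B)
    {E : Set G} (hE : IsCompact E) {δ : ENNReal} (hδ : δ ≠ 0) :
    ∀ᶠ n in atTop, mG (vanHoveBoundary E (B n)) ≤ δ * mG (B n) := by
  filter_upwards [(hB.boundary E hE).eventually_lt_const (pos_iff_ne_zero.2 hδ)] with n hn
  exact (ENNReal.div_le_iff (hB.pos n).ne' (hB.measure_ne_top n)).1 hn.le

theorem IsVanHove.eventually_add_le [IsFiniteMeasureOnCompacts mG] (hB : IsVanHove mG B)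
    {E : Set G} (hE : IsCompact E) {δ : ENNReal} (hδ : δ ≠ 0) :
    ∀ᶠ n in atTop, mG (B n + E) ≤ (1 + δ) * mG (B n) := by
  filter_upwards [hB.eventually_boundary_le hE hδ] with n hn
  have : B n + E ⊆ B n ∪ vanHoveBoundary E (B n) := by
    intro z hz
    by_cases hzB : z ∈ B n
    · exact Or.inl hzB
    · exact Or.inr (Or.inl ⟨add_comm E (B n) ▸ hz, fun h => hzB (interior_subset h)⟩)
  calc _ ≤ _ := measure_mono this
    _ ≤ _ := measure_union_le _ _
    _ ≤ mG (B n) + δ * mG (B n) := by gcongr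
    _ = _ := by ring

end VanHove

/-! ### Iterated integrals of compactly supported functions, without a product σ-algebra -/

section IteratedIntegral

variable {G H E : Type*} [TopologicalSpace G] [TopologicalSpace H] [T2Space G] [T2Space H]
  [NormedAddCommGroup E]
  [MeasurableSpace G] [BorelSpace G] [MeasurableSpace H] [BorelSpace H]

theorem integrable_slice (mH : Measure H) [IsFiniteMeasureOnCompacts mH] {g : G × H → E}
    (hg : Continuous g) (hc : HasCompactSupport g) (t : G) : Integrable (fun h => g (t, h)) mH := by
  refine (hg.comp (by fun_prop : Continuous fun h => (t, h))).integrable_of_hasCompactSupport ?_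
  refine HasCompactSupport.of_support_subset_isCompact (hc.isCompact.image continuous_snd) ?_
  intro h hh
  exact ⟨(t, h), subset_tsupport _ hh, rfl⟩

variable [NormedSpace ℝ E]

theorem continuous_integral_slice (mH : Measure H) [IsFiniteMeasureOnCompacts mH] {g : G × H → E}
    (hg : Continuous g) (hc : HasCompactSupport g) : Continuous fun t => ∫ h, g (t, h) ∂mH := by
  rw [← continuousOn_univ]
  refine continuousOn_integral_of_compact_support (f := fun t h => g (t, h))
    (hc.isCompact.image continuous_snd) hg.continuousOn ?_
  intro t h _ hh
  by_contra hne
  exact hh ⟨(t, h), subset_tsupport _ hne, rfl⟩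

theorem hasCompactSupport_integral_slice (mH : Measure H) {g : G × H → E}
    (hc : HasCompactSupport g) : HasCompactSupport fun t => ∫ h, g (t, h) ∂mH := by
  refine HasCompactSupport.of_support_subset_isCompact (hc.isCompact.image continuous_fst) ?_
  intro t ht
  by_contra hne
  refine ht (integral_eq_zero_of_ae (ae_of_all _ fun h => ?_))
  by_contra hh
  exact hne ⟨(t, h), subset_tsupport _ hh, rfl⟩

theorem integrable_integral_slice (mG : Measure G) [IsFiniteMeasureOnCompacts mG] (mH : Measure H)
    [IsFiniteMeasureOnCompacts mH] {g : G × H → E}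
    (hg : Continuous g) (hc : HasCompactSupport g) :
    Integrable (fun t => ∫ h, g (t, h) ∂mH) mG :=
  (continuous_integral_slice mH hg hc).integrable_of_hasCompactSupport
    (hasCompactSupport_integral_slice mH hc)

/-- Vector values are needed for `E = C(𝕋)`, in averaging over the torus. -/
theorem integral_integral_comp_comm {F : Type*} [NormedAddCommGroup F] [NormedSpace ℝ F]
    [NormedSpace ℂ E] [NormedSpace ℂ F] [CompleteSpace E] [CompleteSpace F]
    (mG : Measure G) [IsFiniteMeasureOnCompacts mG] (mH : Measure H)
    [IsFiniteMeasureOnCompacts mH] {g : G × H → E}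
    (hg : Continuous g) (hc : HasCompactSupport g) (J : E →L[ℂ] F) :
    ∫ t, ∫ h, J (g (t, h)) ∂mH ∂mG = J (∫ t, ∫ h, g (t, h) ∂mH ∂mG) := by
  rw [← J.integral_comp_comm (integrable_integral_slice mG mH hg hc)]
  congr 1 with t
  exact J.integral_comp_comm (integrable_slice mH hg hc t)

theorem norm_integral_integral_le (mG : Measure G) [IsFiniteMeasureOnCompacts mG] (mH : Measure H)
    [IsFiniteMeasureOnCompacts mH] {g : G × H → E} {w : G × H → ℝ} (hw : Continuous w)
    (hwc : HasCompactSupport w) (hgw : ∀ y, ‖g y‖ ≤ w y) :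
    ‖∫ t, ∫ h, g (t, h) ∂mH ∂mG‖ ≤ ∫ t, ∫ h, w (t, h) ∂mH ∂mG :=
  norm_integral_le_of_norm_le (integrable_integral_slice mG mH hw hwc) <| ae_of_all _ fun t =>
    norm_integral_le_of_norm_le (integrable_slice mH hw hwc t) <| ae_of_all _ fun h => hgw (t, h)

end IteratedIntegral

/-! ### The functional `m_G × m_H` -/

section ProdFunctional

variable {G H : Type*} [AddCommGroup G] [TopologicalSpace G] [AddCommGroup H] [TopologicalSpace H]
  [IsTopologicalAddGroup G] [IsTopologicalAddGroup H]
  [T2Space G] [T2Space H] [MeasurableSpace G] [BorelSpace G] [MeasurableSpace H] [BorelSpace H]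
  (mG : Measure G) [mG.IsAddHaarMeasure] (mH : Measure H) [mH.IsAddHaarMeasure]

/-- `prodFunctional` as a linear map. -/
noncomputable def prodLinearMap : C_c(G × H, ℂ) →ₗ[ℂ] ℂ where
  toFun := prodFunctional mG mH
  map_add' f g := by
    simp only [prodFunctional, CompactlySupportedContinuousMap.add_apply]
    rw [← integral_add (integrable_integral_slice mG mH (map_continuous f) f.hasCompactSupport)
      (integrable_integral_slice mG mH (map_continuous g) g.hasCompactSupport)]
    congr 1 with t
    exact integral_add (integrable_slice mH (map_continuous f) f.hasCompactSupport t)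
      (integrable_slice mH (map_continuous g) g.hasCompactSupport t)
  map_smul' c f := by
    simp only [prodFunctional, CompactlySupportedContinuousMap.smul_apply, integral_smul,
      RingHom.id_apply]

theorem prodFunctional_transl (g : C_c(G × H, ℂ)) (x : G × H) :
    prodFunctional mG mH (g.transl x) = prodFunctional mG mH g := by
  simp only [prodFunctional, transl_apply]
  have h1 : ∀ t, ∫ h, g ((t, h) + x) ∂mH = ∫ h, g (t + x.1, h) ∂mH := fun t =>
    integral_add_right_eq_self (μ := mH) (fun h => g (t + x.1, h)) x.2
  simp_rw [h1]
  exact integral_add_right_eq_self (μ := mG) (fun t => ∫ h, g (t, h) ∂mH) x.1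

theorem prodFunctional_cmul_bound (w : C_c(G × H, ℂ)) : ∃ C : ℝ, ∀ (F : C(G × H, ℂ)) (a : ℝ),
    (∀ x, ‖F x‖ ≤ a) → ‖prodFunctional mG mH (cmul F w)‖ ≤ C * a := by
  refine ⟨∫ t, ∫ h, ‖w (t, h)‖ ∂mH ∂mG, fun F a ha => ?_⟩
  refine (norm_integral_integral_le (w := fun y => ‖w y‖ * a) mG mH (by fun_prop)
    w.hasCompactSupport.norm.mul_right fun y => ?_).trans_eq ?_
  · rw [cmul_apply, norm_mul, mul_comm]
    gcongr
    exact ha y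
  · simp_rw [integral_mul_const]

theorem prodFunctional_tensor (φ : C_c(G, ℂ)) (f : C_c(H, ℂ)) :
    prodFunctional mG mH (φ.tensor f) = (∫ t, φ t ∂mG) * ∫ h, f h ∂mH := by
  simp_rw [prodFunctional, tensor_apply, integral_const_mul, integral_mul_const]

theorem prodFunctional_toComplex_ne_zero (w : C_c(G × H, ℝ)) (hw : ∀ y, 0 ≤ w y) {y : G × H}
    (hy : w y ≠ 0) : prodFunctional mG mH w.toComplex ≠ 0 := by
  have h : prodFunctional mG mH w.toComplex = ((∫ t, ∫ h, w (t, h) ∂mH ∂mG : ℝ) : ℂ) := by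
    simp only [prodFunctional, toComplex_apply, integral_complex_ofReal]
  rw [h]
  refine Complex.ofReal_ne_zero.2 (ne_of_gt ?_)
  have hnn : ∀ t, 0 ≤ ∫ h, w (t, h) ∂mH := fun t => integral_nonneg fun h => hw _
  refine Continuous.integral_pos_of_hasCompactSupport_nonneg_nonzero (x := y.1)
    (continuous_integral_slice mH (map_continuous w) w.hasCompactSupport)
    (hasCompactSupport_integral_slice mH w.hasCompactSupport) hnn (ne_of_gt ?_)
  have hs : HasCompactSupport fun h => w (y.1, h) :=
    HasCompactSupport.of_support_subset_isCompact
      (w.hasCompactSupport.isCompact.image continuous_snd)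
      fun h hh => ⟨(y.1, h), subset_tsupport _ hh, rfl⟩
  exact Continuous.integral_pos_of_hasCompactSupport_nonneg_nonzero (x := y.2)
    (by fun_prop) hs (fun h => hw _) hy

end ProdFunctional

/-! ### Coset sums and disintegration over `𝕋` -/

namespace CutProjectScheme

variable {G H : Type*} [AddCommGroup G] [TopologicalSpace G] [AddCommGroup H] [TopologicalSpace H]

instance (S : CutProjectScheme G H) : CompactSpace ((G × H) ⧸ S.lattice) := S.cocompact

variable [IsTopologicalAddGroup G] [LocallyCompactSpace G] [T2Space G]
  [IsTopologicalAddGroup H] [LocallyCompactSpace H] [T2Space H] (S : CutProjectScheme G H)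

theorem finite_lattice_mem {K : Set (G × H)} (hK : IsCompact K) :
    {l : S.lattice | (l : G × H) ∈ K}.Finite := by
  have := S.discrete
  have h := AddSubgroup.tendsto_coe_cofinite_of_discrete S.lattice ⟨S.discrete⟩
    hK.compl_mem_cocompact
  rw [mem_map, mem_cofinite] at h
  refine h.subset fun l hl => ?_
  simpa using hl

theorem finite_lattice_support {E : Type*} [TopologicalSpace E] [Zero E] (g : C_c(G × H, E))
    (x : G × H) : (Function.support fun l : S.lattice => g (x + l)).Finite := by
  refine (S.finite_lattice_mem ((g.hasCompactSupport.isCompact.add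
    (isCompact_singleton (x := -x))))).subset fun l hl => ?_
  exact ⟨x + l, subset_tsupport _ hl, -x, rfl, by simp⟩

theorem summable_lattice {E : Type*} [NormedAddCommGroup E] (g : C_c(G × H, E)) (x : G × H) :
    Summable fun l : S.lattice => g (x + l) :=
  summable_of_hasFiniteSupport (S.finite_lattice_support g x)

theorem cosetSum_toComplex_mk (g : C_c(G × H, ℝ)) (x : G × H) :
    S.cosetSum g.toComplex (QuotientAddGroup.mk x) = ((∑' l : S.lattice, g (x + l) : ℝ) : ℂ) := by
  rw [cosetSum_mk, Complex.ofReal_tsum]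
  rfl

theorem exists_compact_fundamental :
    ∃ C : Set (G × H), IsCompact C ∧ ∀ ξ : S.Torus, ∃ y ∈ C, QuotientAddGroup.mk y = ξ := by
  choose K hK hxK using fun x : G × H => exists_compact_mem_nhds x
  obtain ⟨t, ht⟩ := isCompact_univ.elim_finite_subcover
    (fun x => (QuotientAddGroup.mk : G × H → S.Torus) '' interior (K x))
    (fun x => QuotientAddGroup.isOpenMap_coe _ isOpen_interior) (by
      intro ξ _
      obtain ⟨x, rfl⟩ := QuotientAddGroup.mk_surjective ξ
      exact mem_iUnion.2 ⟨x, x, mem_interior_iff_mem_nhds.2 (hxK x), rfl⟩)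
  refine ⟨⋃ x ∈ t, K x, t.isCompact_biUnion fun x _ => hK x, fun ξ => ?_⟩
  obtain ⟨x, hx, y, hy, rfl⟩ := mem_iUnion₂.1 (ht (mem_univ ξ))
  exact ⟨y, mem_iUnion₂.2 ⟨x, hx, interior_subset hy⟩, rfl⟩

/-- A cutoff equal to `1` on a compact set that meets every coset has positive coset sums; divide it
by them. With such a weight every `F` on `𝕋` is the coset sum of `(F ∘ π) w`, so that a
disintegration has to satisfy `J F = I((F ∘ π) w)`. -/
theorem exists_weight : ∃ w : C_c(G × H, ℝ), (∀ y, 0 ≤ w y) ∧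
    ∀ ξ, S.cosetSum w.toComplex ξ = 1 := by
  obtain ⟨C, hC, hCs⟩ := S.exists_compact_fundamental
  obtain ⟨W, hW1, -, hW0, -⟩ := exists_cutoff hC isOpen_univ (subset_univ C)
  have hpos : ∀ x : G × H, 0 < ∑' l : S.lattice, W (x + l) := by
    intro x
    obtain ⟨y, hy, hyx⟩ := hCs (QuotientAddGroup.mk x)
    have hl : -x + y ∈ S.lattice := QuotientAddGroup.eq.1 hyx.symm
    refine (S.summable_lattice W x).tsum_pos (fun l => hW0 _) ⟨-x + y, hl⟩ ?_
    simp [hW1 y hy]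
  have hre : ∀ x : G × H, (S.cosetSum W.toComplex (QuotientAddGroup.mk x)).re =
      ∑' l : S.lattice, W (x + l) := fun x => by
    rw [cosetSum_toComplex_mk, Complex.ofReal_re]
  have hcont : Continuous fun x : G × H =>
      (S.cosetSum W.toComplex (QuotientAddGroup.mk x)).re :=
    Complex.continuous_re.comp ((S.continuous_cosetSum _).comp QuotientAddGroup.continuous_mk)
  let w : C_c(G × H, ℝ) := ⟨⟨fun x => (S.cosetSum W.toComplex (QuotientAddGroup.mk x)).re⁻¹ * W x,
    (hcont.inv₀ fun x => by rw [hre]; exact (hpos x).ne').mul W.continuous⟩,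
    W.hasCompactSupport.mul_left⟩
  have hw : ∀ x, w x = (∑' l : S.lattice, W (x + l))⁻¹ * W x := fun x => by
    rw [← hre]; rfl
  refine ⟨w, fun y => ?_, fun ξ => ?_⟩
  · rw [hw]
    exact mul_nonneg (inv_nonneg.2 (hpos y).le) (hW0 y)
  · obtain ⟨x, rfl⟩ := QuotientAddGroup.mk_surjective ξ
    rw [cosetSum_toComplex_mk]
    have : ∀ l : S.lattice, w (x + l) = (∑' l : S.lattice, W (x + l))⁻¹ * W (x + l) := by
      intro l
      rw [hw, ← hre, ← hre]
      congr 4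
      simp
    simp_rw [this]
    rw [tsum_mul_left, inv_mul_cancel₀ (hpos x).ne', Complex.ofReal_one]

/-- The function `F ∘ π` on `G × H`. -/
noncomputable def lift (F : C(S.Torus, ℂ)) : C(G × H, ℂ) :=
  ⟨fun x => F (QuotientAddGroup.mk x), F.continuous.comp QuotientAddGroup.continuous_mk⟩

@[simp]
theorem lift_apply (F : C(S.Torus, ℂ)) (x : G × H) : S.lift F x = F (QuotientAddGroup.mk x) := rfl

@[simp]
theorem cosetSumMap_apply (g : C_c(G × H, ℂ)) (ξ : S.Torus) :
    S.cosetSumMap g ξ = S.cosetSum g ξ := rfl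

theorem cosetSumMap_cmul_lift (F : C(S.Torus, ℂ)) {w : C_c(G × H, ℂ)}
    (hw : ∀ ξ, S.cosetSum w ξ = 1) : S.cosetSumMap (cmul (S.lift F) w) = F := by
  ext ξ
  obtain ⟨x, rfl⟩ := QuotientAddGroup.mk_surjective ξ
  have h := hw (QuotientAddGroup.mk x)
  rw [cosetSum_mk] at h
  rw [cosetSumMap_apply, cosetSum_mk]
  have : ∀ l : S.lattice, cmul (S.lift F) w (x + l) = F (QuotientAddGroup.mk x) * w (x + l) := by
    intro l
    rw [cmul_apply, lift_apply]
    congr 2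
    simp
  simp_rw [this]
  rw [tsum_mul_left, h, mul_one]

theorem IsDisintegration.apply_eq {S : CutProjectScheme G H} {I : C_c(G × H, ℂ) → ℂ}
    {J : C(S.Torus, ℂ) →L[ℂ] ℂ} (hJ : S.IsDisintegration I J) (F : C(S.Torus, ℂ))
    {w : C_c(G × H, ℂ)} (hw : ∀ ξ, S.cosetSum w ξ = 1) : J F = I (cmul (S.lift F) w) := by
  rw [hJ, S.cosetSumMap_cmul_lift F hw]

theorem IsDisintegration.apply_one {S : CutProjectScheme G H} {I : C_c(G × H, ℂ) → ℂ}
    {J : C(S.Torus, ℂ) →L[ℂ] ℂ} (hJ : S.IsDisintegration I J)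
    {w : C_c(G × H, ℂ)} (hw : ∀ ξ, S.cosetSum w ξ = 1) : J 1 = I w := by
  rw [hJ]
  congr 1
  ext ξ
  exact (hw ξ).symm

/-- Unfolding: `I((σ(g) ∘ π) w) = ∑ I(w · g(· + l)) = ∑ I(w(· - l) · g) = I(g)`, by invariance and
because the translates of `w` sum to `1`. -/
theorem apply_cmul_cosetSum (I : C_c(G × H, ℂ) →ₗ[ℂ] ℂ)
    (hinv : ∀ l ∈ S.lattice, ∀ g, I (g.transl l) = I g) {w : C_c(G × H, ℂ)}
    (hw : ∀ ξ, S.cosetSum w ξ = 1) (g : C_c(G × H, ℂ)) :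
    I (cmul (S.lift (S.cosetSumMap g)) w) = I g := by
  classical
  -- Only lattice points in `supp g - supp w` contribute, whatever `x` is. All sums are thus finite
  -- sums in `C_c`, and linearity of `I` suffices.
  have hfin : {l : S.lattice | ∃ x, w x ≠ 0 ∧ g (x + l) ≠ 0}.Finite := by
    refine (S.finite_lattice_mem (g.hasCompactSupport.isCompact.add
      w.hasCompactSupport.isCompact.neg)).subset ?_
    rintro l ⟨x, hx, hl⟩
    exact ⟨x + l, subset_tsupport _ hl, -x, by simpa using subset_tsupport _ hx, by simp⟩
  set T := hfin.toFinset with hT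
  have hmem : ∀ {l : S.lattice}, l ∉ T → ∀ x, w x ≠ 0 → g (x + l) = 0 := by
    intro l hl x hx
    by_contra hne
    exact hl (hfin.mem_toFinset.2 ⟨x, hx, hne⟩)
  have h1 : cmul (S.lift (S.cosetSumMap g)) w = ∑ l ∈ T, w * g.transl (l : G × H) := by
    ext x
    rw [CompactlySupportedContinuousMap.sum_apply, cmul_apply, lift_apply, cosetSumMap_apply,
      cosetSum_mk]
    simp only [CompactlySupportedContinuousMap.mul_apply, transl_apply]
    by_cases hx : w x = 0
    · simp [hx]
    · rw [← Finset.mul_sum, mul_comm, tsum_eq_sum fun l hl => hmem hl x hx]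
  have h2 : g = ∑ l ∈ T, w.transl (-(l : G × H)) * g := by
    ext x
    rw [CompactlySupportedContinuousMap.sum_apply]
    simp only [CompactlySupportedContinuousMap.mul_apply, transl_apply]
    by_cases hx : g x = 0
    · simp [hx]
    · have h := hw (QuotientAddGroup.mk x)
      rw [cosetSum_mk, ← (Equiv.neg S.lattice).tsum_eq, tsum_eq_sum (s := T)] at h
      · rw [← Finset.sum_mul]
        simp only [Equiv.neg_apply, AddSubgroup.coe_neg] at h
        rw [h, one_mul]
      · intro l hl
        by_contra hne
        refine hx ?_
        have := hmem hl _ hne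
        simpa using this
  rw [h1]
  conv_rhs => rw [h2]
  rw [map_sum, map_sum]
  refine Finset.sum_congr rfl fun l _ => ?_
  rw [← hinv l l.2 (w.transl (-(l : G × H)) * g)]
  congr 1
  ext x
  simp

/-- The formula `J F = I((F ∘ π) w)` defines the functional and also forces it; `hb` gives its
continuity. -/
theorem existsUnique_isDisintegration (I : C_c(G × H, ℂ) →ₗ[ℂ] ℂ)
    (hinv : ∀ l ∈ S.lattice, ∀ g, I (g.transl l) = I g)
    (hb : ∀ w : C_c(G × H, ℂ), ∃ C : ℝ, ∀ (F : C(G × H, ℂ)) (a : ℝ),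
      (∀ x, ‖F x‖ ≤ a) → ‖I (cmul F w)‖ ≤ C * a) :
    ∃! J : C(S.Torus, ℂ) →L[ℂ] ℂ, S.IsDisintegration I J := by
  obtain ⟨w₀, -, hw⟩ := S.exists_weight
  set w := w₀.toComplex
  obtain ⟨C, hC⟩ := hb w
  let J₀ : C(S.Torus, ℂ) →ₗ[ℂ] ℂ :=
    { toFun := fun F => I (cmul (S.lift F) w)
      map_add' := fun F F' => by
        rw [← map_add]
        congr 1
        ext x
        simp [add_mul]
      map_smul' := fun c F => by
        rw [RingHom.id_apply, ← map_smul]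
        congr 1
        ext x
        simp [mul_assoc] }
  refine ⟨J₀.mkContinuous C fun F => hC (S.lift F) ‖F‖ fun x => F.norm_coe_le_norm _, ?_, ?_⟩
  · intro g
    exact (S.apply_cmul_cosetSum I hinv hw g).symm
  · intro J hJ
    ext F
    exact hJ.apply_eq F hw

/-- The translates of `F`: `shift F ξ η = F (η + ξ)`. -/
noncomputable def shift (F : C(S.Torus, ℂ)) : C(S.Torus, C(S.Torus, ℂ)) :=
  ContinuousMap.curry ⟨fun p : S.Torus × S.Torus => F (p.2 + p.1),
    F.continuous.comp (continuous_snd.add continuous_fst)⟩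

@[simp]
theorem shift_apply (F : C(S.Torus, ℂ)) (ξ η : S.Torus) : S.shift F ξ η = F (η + ξ) := rfl

theorem cosetSumMap_transl (g : C_c(G × H, ℂ)) (x : G × H) :
    S.cosetSumMap (g.transl x) = S.shift (S.cosetSumMap g) (QuotientAddGroup.mk x) := by
  ext ξ
  obtain ⟨y, rfl⟩ := QuotientAddGroup.mk_surjective ξ
  rw [shift_apply, ← QuotientAddGroup.mk_add, cosetSumMap_apply, cosetSumMap_apply, cosetSum_mk,
    cosetSum_mk]
  refine tsum_congr fun l => ?_
  rw [transl_apply, add_right_comm]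

variable [MeasurableSpace G] [BorelSpace G] [MeasurableSpace H] [BorelSpace H]
  (mG : Measure G) [mG.IsAddHaarMeasure] (mH : Measure H) [mH.IsAddHaarMeasure]

theorem existsUnique_prodFunctional :
    ∃! mT : C(S.Torus, ℂ) →L[ℂ] ℂ, S.IsDisintegration (prodFunctional mG mH) mT :=
  S.existsUnique_isDisintegration (prodLinearMap mG mH)
    (fun l _ g => prodFunctional_transl mG mH g l) (prodFunctional_cmul_bound mG mH)

variable {S mG mH} {mT : C(S.Torus, ℂ) →L[ℂ] ℂ}

theorem haar_one_ne_zero (hmT : S.IsDisintegration (prodFunctional mG mH) mT) : mT 1 ≠ 0 := by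
  obtain ⟨w, hw0, hw⟩ := S.exists_weight
  rw [hmT.apply_one hw]
  obtain ⟨y, hy⟩ : ∃ y, w y ≠ 0 := by
    by_contra! h
    have := hw 0
    rw [← QuotientAddGroup.mk_zero, cosetSum_toComplex_mk] at this
    simp [h] at this
  exact prodFunctional_toComplex_ne_zero mG mH w hw0 hy

/-- `m_G × m_H` is invariant under all of `G × H`, not only under the lattice. -/
theorem haar_shift (hmT : S.IsDisintegration (prodFunctional mG mH) mT) (F : C(S.Torus, ℂ))
    (ξ : S.Torus) : mT (S.shift F ξ) = mT F := by
  obtain ⟨w, -, hw⟩ := S.exists_weight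
  obtain ⟨x, rfl⟩ := QuotientAddGroup.mk_surjective ξ
  have h := S.cosetSumMap_cmul_lift F hw
  rw [← h, ← cosetSumMap_transl, ← hmT, ← hmT, prodFunctional_transl]

/-- Averaging `ξ ↦ J (F (· + ξ))` over the torus. -/
theorem haar_average (hmT : S.IsDisintegration (prodFunctional mG mH) mT) (F : C(S.Torus, ℂ))
    (J : C(S.Torus, ℂ) →L[ℂ] ℂ) :
    mT ((J : C(C(S.Torus, ℂ), ℂ)).comp (S.shift F)) = J 1 * mT F := by
  obtain ⟨w, -, hw⟩ := S.exists_weight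
  let Φ : G × H → C(S.Torus, ℂ) := fun x => w.toComplex x • S.shift F (QuotientAddGroup.mk x)
  have hΦ : Continuous Φ := w.toComplex.continuous.smul
    ((S.shift F).continuous.comp QuotientAddGroup.continuous_mk)
  have hΦc : HasCompactSupport Φ := w.toComplex.hasCompactSupport.smul_right
  -- The average of the translates of `F` exists as one `C(𝕋)`-valued integral, from which any
  -- functional `J'` can be pulled out.
  have key : ∀ J' : C(S.Torus, ℂ) →L[ℂ] ℂ, mT ((J' : C(C(S.Torus, ℂ), ℂ)).comp (S.shift F)) =
      J' (∫ t, ∫ h, Φ (t, h) ∂mH ∂mG) := by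
    intro J'
    rw [hmT.apply_eq _ hw, ← integral_integral_comp_comm mG mH hΦ hΦc J', prodFunctional]
    congr 1 with t
    congr 1 with h
    simp [Φ, mul_comm]
  -- Taking evaluations for `J'` identifies that integral: by invariance of Haar measure it is the
  -- constant `mT F`.
  have hconst : ∫ t, ∫ h, Φ (t, h) ∂mH ∂mG = mT F • (1 : C(S.Torus, ℂ)) := by
    ext η
    have h := key (ContinuousMap.evalCLM ℂ η)
    have h2 : ((ContinuousMap.evalCLM ℂ η : C(S.Torus, ℂ) →L[ℂ] ℂ) : C(C(S.Torus, ℂ), ℂ)).comp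
        (S.shift F) = S.shift F η := by
      ext ξ
      simp [add_comm]
    rw [h2, haar_shift hmT] at h
    simpa using h.symm
  rw [key, hconst, map_smul, smul_eq_mul, mul_comm]

end CutProjectScheme

/-! ### Complex Radon measures are determined by their values on `C_c` -/

theorem MeasureTheory.Measure.regular_add {X : Type*} [TopologicalSpace X] [MeasurableSpace X]
    [BorelSpace X] [T2Space X] (μ ν : Measure X) [μ.Regular] [ν.Regular] : (μ + ν).Regular where
  lt_top_of_isCompact K hK := by
    rw [Measure.add_apply]
    exact ENNReal.add_lt_top.2 ⟨hK.measure_lt_top, hK.measure_lt_top⟩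
  outerRegular A hA r hr := by
    rw [Measure.add_apply] at hr
    have hμ : μ A ≠ ⊤ := (lt_of_le_of_lt le_self_add hr).ne_top
    have hν : ν A ≠ ⊤ := (lt_of_le_of_lt le_add_self hr).ne_top
    obtain ⟨δ, hδ, hδr⟩ : ∃ δ : ENNReal, 0 < δ ∧ μ A + δ + (ν A + δ) < r := by
      obtain ⟨δ, hδ, h⟩ := ENNReal.lt_iff_exists_add_pos_lt.1 hr
      refine ⟨δ / 2, by simpa using hδ.ne', ?_⟩
      calc _ = μ A + ν A + ((δ : ENNReal) / 2 + δ / 2) := by ring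
        _ < r := by rwa [ENNReal.add_halves]
    obtain ⟨U, hAU, hU, hUr⟩ := A.exists_isOpen_lt_of_lt _ (ENNReal.lt_add_right hμ hδ.ne')
    obtain ⟨V, hAV, hV, hVr⟩ := A.exists_isOpen_lt_of_lt _ (ENNReal.lt_add_right hν hδ.ne')
    refine ⟨U ∩ V, subset_inter hAU hAV, hU.inter hV, lt_of_le_of_lt ?_ hδr⟩
    rw [Measure.add_apply]
    exact add_le_add ((measure_mono inter_subset_left).trans hUr.le)
      ((measure_mono inter_subset_right).trans hVr.le)
  innerRegular U hU r hr := by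
    rw [Measure.add_apply] at hr
    -- Splitting `r < μ U + ν U` into `a < μ U` and `b < ν U` is possible only if both masses are
    -- nonzero.
    rcases eq_or_ne (μ U) 0 with h | h
    · rw [h, zero_add] at hr
      obtain ⟨K, hKU, hK, hrK⟩ := hU.exists_lt_isCompact hr
      exact ⟨K, hKU, hK, hrK.trans_le (by simp)⟩
    rcases eq_or_ne (ν U) 0 with h' | h'
    · rw [h', add_zero] at hr
      obtain ⟨K, hKU, hK, hrK⟩ := hU.exists_lt_isCompact hr
      exact ⟨K, hKU, hK, hrK.trans_le (by simp)⟩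
    obtain ⟨a, ha, b, hb, hab⟩ := ENNReal.exists_lt_add_of_lt_add hr h h'
    obtain ⟨K, hKU, hK, haK⟩ := hU.exists_lt_isCompact ha
    obtain ⟨K', hKU', hK', hbK⟩ := hU.exists_lt_isCompact hb
    refine ⟨K ∪ K', union_subset hKU hKU', hK.union hK', hab.trans_le ?_⟩
    rw [Measure.add_apply]
    exact add_le_add (haK.le.trans (measure_mono subset_union_left))
      (hbK.le.trans (measure_mono subset_union_right))

namespace ComplexRadonMeasure

section General

variable {X : Type*} [TopologicalSpace X] [LocallyCompactSpace X] [T2Space X]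
  [SigmaCompactSpace X] (ρ : ComplexRadonMeasure X)

theorem integrable_cc {E : Type*} [NormedAddCommGroup E] (g : C_c(X, E)) :
    Integrable g ρ.variation := by
  let _ := borel X
  have : BorelSpace X := ⟨rfl⟩
  have := ρ.regular
  exact (map_continuous g).integrable_of_hasCompactSupport g.hasCompactSupport

theorem integrable_mul_phase {F : X → ℂ} (hF : Integrable F ρ.variation) :
    Integrable (fun x => F x * ρ.phase x) ρ.variation :=
  hF.mul_bdd (c := 1) ρ.measurable_phase.aestronglyMeasurable
    (ae_of_all _ fun x => (ρ.norm_phase x).le)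

theorem integral_add {F F' : X → ℂ} (hF : Integrable F ρ.variation)
    (hF' : Integrable F' ρ.variation) :
    ρ.integral (fun x => F x + F' x) = ρ.integral F + ρ.integral F' := by
  rw [integral, integral, integral,
    ← MeasureTheory.integral_add (ρ.integrable_mul_phase hF) (ρ.integrable_mul_phase hF')]
  simp only [add_mul]

theorem integral_sub {F F' : X → ℂ} (hF : Integrable F ρ.variation)
    (hF' : Integrable F' ρ.variation) :
    ρ.integral (fun x => F x - F' x) = ρ.integral F - ρ.integral F' := by
  rw [integral, integral, integral,
    ← MeasureTheory.integral_sub (ρ.integrable_mul_phase hF) (ρ.integrable_mul_phase hF')]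
  simp only [sub_mul]

theorem integral_const_mul (c : ℂ) (F : X → ℂ) :
    ρ.integral (fun x => c * F x) = c * ρ.integral F := by
  rw [integral, integral, ← MeasureTheory.integral_const_mul]
  simp only [mul_assoc]

theorem enorm_integral_le (F : X → ℂ) : ‖ρ.integral F‖ₑ ≤ ∫⁻ x, ‖F x‖ₑ ∂ρ.variation := by
  refine (enorm_integral_le_lintegral_enorm _).trans_eq (lintegral_congr fun x => ?_)
  rw [enorm_mul, ← ofReal_norm (ρ.phase x), ρ.norm_phase, ENNReal.ofReal_one, mul_one]

theorem norm_integral_le (F : X → ℂ) : ‖ρ.integral F‖ ≤ ∫ x, ‖F x‖ ∂ρ.variation := by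
  refine (norm_integral_le_integral_norm _).trans_eq ?_
  congr 1 with x
  rw [norm_mul, ρ.norm_phase, mul_one]

/-- `ρ` as a linear functional on `C_c(X)`. -/
noncomputable def toLinearMap : C_c(X, ℂ) →ₗ[ℂ] ℂ where
  toFun g := ρ.integral g
  map_add' f g := ρ.integral_add (ρ.integrable_cc f) (ρ.integrable_cc g)
  map_smul' c f := ρ.integral_const_mul c f

theorem cmul_bound (w : C_c(X, ℂ)) (F : C(X, ℂ)) (a : ℝ) (ha : ∀ x, ‖F x‖ ≤ a) :
    ‖ρ.integral (cmul F w)‖ ≤ (∫ x, ‖w x‖ ∂ρ.variation) * a := by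
  refine (ρ.norm_integral_le _).trans ?_
  rw [← MeasureTheory.integral_mul_const]
  refine integral_mono (ρ.integrable_cc _).norm ((ρ.integrable_cc w).norm.mul_const a) fun x => ?_
  simp only [cmul_apply, norm_mul]
  rw [mul_comm]
  gcongr
  exact ha x

/-- Two complex Radon measures that agree on `C_c(X)` agree on all functions integrable for both. -/
theorem integral_eq_of_forall_cc {ρ₁ ρ₂ : ComplexRadonMeasure X}
    (h : ∀ g : C_c(X, ℂ), ρ₁.integral g = ρ₂.integral g) {F : X → ℂ}
    (h₁ : Integrable F ρ₁.variation) (h₂ : Integrable F ρ₂.variation) :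
    ρ₁.integral F = ρ₂.integral F := by
  refine eq_of_forall_dist_le fun ε hε => ?_
  -- Approximating in `L¹` of the sum of the variations gives a single `g` that is good for both
  -- measures.
  obtain ⟨g, hg⟩ : ∃ g : C_c(X, ℂ), ∫⁻ x, ‖F x - g x‖ₑ ∂(ρ₁.variation + ρ₂.variation) ≤
      ENNReal.ofReal (ε / 2) := by
    let _ := borel X
    have : BorelSpace X := ⟨rfl⟩
    have := ρ₁.regular
    have := ρ₂.regular
    have := Measure.regular_add ρ₁.variation ρ₂.variation
    obtain ⟨g, hgc, hg, hgcont, -⟩ :=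
      (h₁.add_measure h₂).exists_hasCompactSupport_lintegral_sub_le (ε := ENNReal.ofReal (ε / 2))
        (by simpa using hε)
    exact ⟨⟨⟨g, hgcont⟩, hgc⟩, hg⟩
  rw [lintegral_add_measure] at hg
  have key : ∀ ρ : ComplexRadonMeasure X, Integrable F ρ.variation →
      ∫⁻ x, ‖F x - g x‖ₑ ∂ρ.variation ≤ ENNReal.ofReal (ε / 2) →
      ‖ρ.integral F - ρ.integral g‖ ≤ ε / 2 := by
    intro ρ hF hle
    rw [← ρ.integral_sub hF (ρ.integrable_cc g)]
    have := (ρ.enorm_integral_le _).trans hle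
    rwa [← ofReal_norm, ENNReal.ofReal_le_ofReal_iff (by positivity)] at this
  have k₁ := key ρ₁ h₁ (le_self_add.trans hg)
  have k₂ := key ρ₂ h₂ (le_add_self.trans hg)
  rw [← h g] at k₂
  rw [dist_eq_norm]
  calc _ = ‖(ρ₁.integral F - ρ₁.integral g) - (ρ₂.integral F - ρ₁.integral g)‖ := by
        congr 1; ring
    _ ≤ ε / 2 + ε / 2 := (norm_sub_le _ _).trans (add_le_add k₁ k₂)
    _ = ε := by ring

/-- Test with `F = 1_K` times the conjugate phase of `ρ₁`: then `ρ₁(F) = |ρ₁|(K)`, while `|ρ₂(F)| ≤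
|ρ₂|(K)`. -/
theorem variation_le_of_forall_cc {ρ₁ ρ₂ : ComplexRadonMeasure X}
    (h : ∀ g : C_c(X, ℂ), ρ₁.integral g = ρ₂.integral g) {K : Set X} (hK : IsCompact K) :
    ρ₁.variation K ≤ ρ₂.variation K := by
  let _ := borel X
  have : BorelSpace X := ⟨rfl⟩
  have := ρ₁.regular
  have := ρ₂.regular
  have hKm := hK.measurableSet
  let F : X → ℂ := K.indicator fun x => star (ρ₁.phase x)
  have hF : ∀ ρ : ComplexRadonMeasure X, Integrable F ρ.variation := by
    intro ρ
    have := ρ.regular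
    refine IntegrableOn.integrable_indicator ?_ hKm
    refine Measure.integrableOn_of_bounded (M := 1) hK.measure_ne_top
      (continuous_star.measurable.comp ρ₁.measurable_phase).aestronglyMeasurable
      (ae_of_all _ fun x => ?_)
    rw [norm_star, ρ₁.norm_phase]
  have h1 : ρ₁.integral F = (ρ₁.variation.real K : ℂ) := by
    have : (fun x => F x * ρ₁.phase x) = K.indicator fun _ => (1 : ℂ) := by
      ext x
      by_cases hx : x ∈ K
      · simp only [F, indicator_of_mem hx]
        have := ρ₁.norm_phase x
        rw [Complex.star_def, mul_comm, Complex.mul_conj, Complex.normSq_eq_norm_sq, this]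
        simp
      · simp [F, hx]
    rw [integral, this, integral_indicator hKm]
    simp
  have h2 : ‖ρ₂.integral F‖ₑ ≤ ρ₂.variation K := by
    refine (ρ₂.enorm_integral_le F).trans_eq ?_
    have : ∀ x, ‖F x‖ₑ = K.indicator 1 x := by
      intro x
      by_cases hx : x ∈ K
      · simp only [F, indicator_of_mem hx]
        rw [← ofReal_norm, norm_star, ρ₁.norm_phase]
        simp
      · simp [F, hx]
    simp_rw [this]
    exact lintegral_indicator_one hKm
  rw [← integral_eq_of_forall_cc h (hF ρ₁) (hF ρ₂), h1] at h2
  refine le_trans (le_of_eq ?_) h2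
  rw [← ofReal_norm, Complex.norm_real, Real.norm_of_nonneg measureReal_nonneg,
    ofReal_measureReal hK.measure_ne_top]

theorem variation_eq_of_forall_cc {ρ₁ ρ₂ : ComplexRadonMeasure X}
    (h : ∀ g : C_c(X, ℂ), ρ₁.integral g = ρ₂.integral g) : ρ₁.variation = ρ₂.variation := by
  let _ := borel X
  have : BorelSpace X := ⟨rfl⟩
  have := ρ₁.regular
  have := ρ₂.regular
  refine Measure.OuterRegular.ext_isOpen fun U hU => ?_
  rw [hU.measure_eq_iSup_isCompact, hU.measure_eq_iSup_isCompact]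
  refine iSup_congr fun K => iSup_congr fun _ => iSup_congr fun hK => ?_
  exact le_antisymm (variation_le_of_forall_cc h hK)
    (variation_le_of_forall_cc (fun g => (h g).symm) hK)

/-- The total variation `|ρ|`, as a (positive) complex Radon measure. -/
noncomputable def abs : ComplexRadonMeasure X where
  variation := ρ.variation
  regular := ρ.regular
  phase := 1
  measurable_phase := @measurable_const _ _ _ (borel X) 1
  norm_phase := by simp

@[simp]
theorem abs_variation : ρ.abs.variation = ρ.variation := rfl

theorem abs_integral (F : X → ℂ) : ρ.abs.integral F = ∫ x, F x ∂ρ.variation := by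
  simp [integral, abs]

theorem integral_variation_ofReal (F : X → ℝ) :
    ∫ x, (F x : ℂ) ∂ρ.variation = ((∫ x, F x ∂ρ.variation : ℝ) : ℂ) :=
  @integral_complex_ofReal X (borel X) ρ.variation F

theorem variation_eq_zero_of_integral_norm_eq_zero
    (h : ∀ g : C_c(X, ℂ), ∫ x, ‖g x‖ ∂ρ.variation = 0) : ρ.variation = 0 := by
  let _ := borel X
  have : BorelSpace X := ⟨rfl⟩
  have hK : ∀ K : Set X, IsCompact K → ρ.variation K = 0 := by
    intro K hK
    obtain ⟨θ, h1, -, -, -⟩ := exists_cutoff hK isOpen_univ (subset_univ K)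
    have h0 := h θ.toComplex
    rw [integral_eq_zero_iff_of_nonneg (fun x => norm_nonneg _)
      (ρ.integrable_cc θ.toComplex).norm] at h0
    refine measure_mono_null (fun x hx => ?_) h0
    simp [h1 x hx]
  rw [← Measure.measure_univ_eq_zero, ← iUnion_compactCovering X]
  exact measure_iUnion_null fun n => hK _ (isCompact_compactCovering X n)

end General

section Invariant

variable {X : Type*} [TopologicalSpace X] [AddCommGroup X] [IsTopologicalAddGroup X]
  [LocallyCompactSpace X] [T2Space X] [SigmaCompactSpace X]
  {ρ : ComplexRadonMeasure X} {L : AddSubgroup X}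

/-- The translate of `ρ`, with `∫ F d(ρ.transl l) = ∫ F (x + l) dρ(x)`. -/
noncomputable def transl (ρ : ComplexRadonMeasure X) (l : X) : ComplexRadonMeasure X where
  variation := @Measure.map X X (borel X) (borel X) (fun x => x + l) ρ.variation
  regular := by
    let _ := borel X
    have : BorelSpace X := ⟨rfl⟩
    have := ρ.regular
    exact Measure.Regular.map (Homeomorph.addRight l)
  phase x := ρ.phase (x - l)
  measurable_phase := by
    let _ := borel X
    have : BorelSpace X := ⟨rfl⟩
    exact ρ.measurable_phase.comp (continuous_sub_right l).measurable
  norm_phase x := ρ.norm_phase _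

theorem transl_integral (ρ : ComplexRadonMeasure X) (l : X) (F : X → ℂ) :
    (ρ.transl l).integral F = ρ.integral fun x => F (x + l) := by
  let _ := borel X
  have : BorelSpace X := ⟨rfl⟩
  have h := (Homeomorph.addRight l).measurableEmbedding.integral_map (μ := ρ.variation)
    (fun x => F x * ρ.phase (x - l))
  refine h.trans ?_
  simp [integral]

/-- Invariance is assumed on `C_c` only. Uniqueness of the polar form's variation carries it over to
`|ρ|`, and then to integrals of discontinuous functions such as `muIntegrand`. -/
theorem IsInvariant.transl_variation (hρ : ρ.IsInvariant L) {l : X} (hl : l ∈ L) :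
    (ρ.transl l).variation = ρ.variation :=
  variation_eq_of_forall_cc fun g => (transl_integral ρ l g).trans (hρ l hl g)

theorem IsInvariant.integral_add_right (hρ : ρ.IsInvariant L) {l : X} (hl : l ∈ L)
    {F : X → ℂ} (hF : Integrable F ρ.variation) :
    ρ.integral (fun x => F (x + l)) = ρ.integral F := by
  rw [← transl_integral]
  exact integral_eq_of_forall_cc (fun g => (transl_integral ρ l g).trans (hρ l hl g))
    (by rwa [hρ.transl_variation hl]) hF

theorem IsInvariant.abs (hρ : ρ.IsInvariant L) : ρ.abs.IsInvariant L := by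
  let _ := borel X
  have : BorelSpace X := ⟨rfl⟩
  intro l hl g
  rw [abs_integral, abs_integral]
  conv_rhs => rw [← hρ.transl_variation hl]
  exact ((Homeomorph.addRight l).measurableEmbedding.integral_map (μ := ρ.variation) g).symm

end Invariant

end ComplexRadonMeasure

/-! ### Cutoffs and uniform continuity on topological groups -/

section TopologicalGroup

variable {G : Type*} [AddCommGroup G] [TopologicalSpace G] [IsTopologicalAddGroup G]

theorem exists_symm_compact_nhds_zero [LocallyCompactSpace G] :
    ∃ K : Set G, IsCompact K ∧ K ∈ 𝓝 0 ∧ -K = K := by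
  obtain ⟨K, hK, hK0⟩ := exists_compact_mem_nhds (0 : G)
  refine ⟨K ∪ -K, hK.union hK.neg, mem_of_superset hK0 subset_union_left, ?_⟩
  rw [Set.union_neg, neg_neg, union_comm]

theorem closure_subset_add_interior {K : Set G} (hK : K ∈ 𝓝 0) (B : Set G) :
    closure B ⊆ B + interior K := by
  intro x hx
  have hcont : Continuous fun b => x - b := continuous_const.sub continuous_id
  have hopen : IsOpen {b | x - b ∈ interior K} := isOpen_interior.preimage hcont
  obtain ⟨b, hb, hbB⟩ := mem_closure_iff.1 hx _ hopen
    (by simpa using mem_interior_iff_mem_nhds.2 hK)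
  exact ⟨b, hbB, x - b, hb, by simp⟩

/-- A continuous compactly supported approximation of the indicator function of `B`. -/
theorem exists_cutoff_add [LocallyCompactSpace G] [T2Space G] {K B : Set G} (hK : K ∈ 𝓝 0)
    (hB : IsCompact (closure B)) :
    ∃ u : C_c(G, ℝ), (∀ t ∈ B, u t = 1) ∧ (∀ t, t ∉ B + K → u t = 0) ∧ (∀ t, 0 ≤ u t) ∧
      ∀ t, u t ≤ 1 := by
  obtain ⟨u, h1, h0, hn, hle⟩ := exists_cutoff hB (isOpen_interior.add_left (s := B))
    (closure_subset_add_interior hK B)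
  exact ⟨u, fun t ht => h1 t (subset_closure ht),
    fun t ht => h0 t fun h => ht (add_subset_add_left interior_subset h), hn, hle⟩

/-- Uniform continuity, with `Q` and `V₀` fixed before `δ`: in the application `δ` depends on the
mass of strips over `Q`. -/
theorem exists_nhds_norm_sub_le [LocallyCompactSpace G] {E : Type*} [NormedAddCommGroup E]
    (f : C_c(G, E)) :
    ∃ Q : Set G, IsCompact Q ∧ tsupport f ⊆ Q ∧ ∃ V₀ ∈ 𝓝 (0 : G),
      (∀ v ∈ V₀, ∀ h, f (h + v) ≠ 0 → h ∈ Q) ∧ ∀ δ : ℝ, 0 < δ →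
      ∃ V ∈ 𝓝 (0 : G), V ⊆ V₀ ∧ ∀ v ∈ V, ∀ h, ‖f (h + v) - f h‖ ≤ δ := by
  obtain ⟨V₀, hV₀, hV₀0, hsymm⟩ := exists_symm_compact_nhds_zero (G := G)
  have hQ : IsCompact (tsupport f + V₀) := f.hasCompactSupport.isCompact.add hV₀
  have hsub : tsupport f ⊆ tsupport f + V₀ := fun h hh => ⟨h, hh, 0, mem_of_mem_nhds hV₀0, by simp⟩
  have hmem : ∀ v ∈ V₀, ∀ h, f (h + v) ≠ 0 → h ∈ tsupport f + V₀ := fun v hv h hne =>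
    ⟨h + v, subset_tsupport _ hne, -v, by rw [← hsymm]; simpa using hv, by simp⟩
  refine ⟨tsupport f + V₀, hQ, hsub, V₀, hV₀0, hmem, fun δ hδ => ?_⟩
  have hev : ∀ᶠ v in 𝓝 (0 : G), ∀ h ∈ tsupport f + V₀, ‖f (h + v) - f h‖ < δ := by
    refine hQ.eventually_forall_of_forall_eventually fun h _ => ?_
    have hc : Continuous fun p : G × G => ‖f (p.2 + p.1) - f p.2‖ := by fun_prop
    have := hc.tendsto (0, h)
    exact this.eventually_lt_const (by simpa using hδ)
  refine ⟨_, inter_mem hV₀0 hev, inter_subset_left, fun v hv h => ?_⟩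
  by_cases hh : h ∈ tsupport f + V₀
  · exact (hv.2 h hh).le
  · have h1 : f (h + v) = 0 := by
      by_contra hne
      exact hh (hmem v hv.1 h hne)
    have h2 : f h = 0 := by
      by_contra hne
      exact hh (hsub (subset_tsupport _ hne))
    simp [h1, h2, hδ.le]

end TopologicalGroup

/-! ### Translation bounded measures: mass of strips and of boundary layers -/

section TranslationBounded

/-- `∫ |g(y + x)| dv(y)` is bounded in `x`, for all `g ∈ C_c(X)`. -/
def TranslationBounded {X : Type*} [TopologicalSpace X] [AddGroup X]
    (v : @Measure X (borel X)) : Prop :=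
  ∀ g : C_c(X, ℂ), ∃ M : ℝ, ∀ x, ∫⁻ y, ‖g (y + x)‖ₑ ∂v ≤ ENNReal.ofReal M

variable {G H : Type*} [AddCommGroup G] [TopologicalSpace G] [IsTopologicalAddGroup G]
  [LocallyCompactSpace G] [T2Space G] [MeasurableSpace G] [BorelSpace G]
  [AddCommGroup H] [TopologicalSpace H] [IsTopologicalAddGroup H]
  [LocallyCompactSpace H] [T2Space H] [MeasurableSpace H] [BorelSpace H]
  {mG : Measure G} [mG.IsAddHaarMeasure] {v : @Measure (G × H) (borel (G × H))}

/-- A function `φ ⊗ θ` that dominates the indicator of `(K - K) × Q` bounds the mass of all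
translates of this box; the covering estimate then treats any base `A`. -/
theorem TranslationBounded.exists_strip_bound (hv : TranslationBounded v) {K : Set G}
    (hK : IsCompact K) (hK0 : K ∈ 𝓝 0) {Q : Set H} (hQ : IsCompact Q) :
    ∃ M : ENNReal, M ≠ ⊤ ∧ ∀ A : Set G, mG (A + K) ≠ ⊤ → ∀ x : G × H,
      ∫⁻ y, A.indicator 1 (y.1 + x.1) * Q.indicator 1 (y.2 + x.2) ∂v ≤ M * mG (A + K) := by
  have hKK : IsCompact (K - K) := by
    rw [sub_eq_add_neg]
    exact hK.add hK.neg
  obtain ⟨φ, hφ1, -, -, -⟩ := exists_cutoff hKK isOpen_univ (subset_univ _)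
  obtain ⟨θ, hθ1, -, -, -⟩ := exists_cutoff hQ isOpen_univ (subset_univ _)
  obtain ⟨M, hM⟩ := hv (φ.toComplex.tensor θ.toComplex)
  have hmK : mG K ≠ 0 := (Measure.measure_pos_of_mem_nhds mG hK0).ne'
  refine ⟨ENNReal.ofReal M / mG K, ENNReal.div_ne_top ENNReal.ofReal_ne_top hmK,
    fun A hA x => ?_⟩
  have h := lintegral_strip_le mG hK hmK (v := v) (φ := fun t => ‖φ t‖ₑ)
    (q := Q.indicator 1) (M := ENNReal.ofReal M)
    (map_continuous φ).measurable.enorm (fun t ht => by simp [hφ1 t ht])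
    (measurable_one.indicator hQ.measurableSet) (fun x => ?_) hA x
  · rw [← ENNReal.mul_div_right_comm, ENNReal.le_div_iff_mul_le (Or.inl hmK)
      (Or.inl hK.measure_ne_top)]
    exact h
  · refine le_trans (lintegral_mono fun y => ?_) (hM x)
    simp only [tensor_apply, toComplex_apply, enorm_mul, Prod.fst_add, Prod.snd_add]
    refine mul_le_mul' (by simp [← ofReal_norm]) ?_
    by_cases hy : y.2 + x.2 ∈ Q
    · simp [hy, hθ1 _ hy]
    · simp [hy]

variable {B : ℕ → Set G}

theorem TranslationBounded.eventually_boundary_le (hv : TranslationBounded v)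
    (hB : IsVanHove mG B) {D : Set G} (hD : IsCompact D) (hDs : -D = D) {Q : Set H}
    (hQ : IsCompact Q) {δ : ENNReal} (hδ : δ ≠ 0) :
    ∀ᶠ n in atTop, ∀ x : G × H,
      ∫⁻ y, ((B n + D) ∩ ((B n)ᶜ + D)).indicator 1 (y.1 + x.1) * Q.indicator 1 (y.2 + x.2) ∂v ≤
        δ * mG (B n) := by
  obtain ⟨K, hK, hK0, hKs⟩ := exists_symm_compact_nhds_zero (G := G)
  obtain ⟨M, hMt, hM⟩ := hv.exists_strip_bound (mG := mG) hK hK0 hQ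
  have hE : IsCompact (D + K) := hD.add hK
  -- The case `M = 0` is allowed: then `δ / M = ⊤`, and only `M * (δ / M) ≤ δ` is used in the end.
  have hδM : δ / M ≠ 0 := (ENNReal.div_pos hδ hMt).ne'
  filter_upwards [hB.eventually_boundary_le hE hδM] with n hn x
  -- The strip bound thickens the layer by `K`, and the thickened layer still lies in a van Hove
  -- boundary, for `D + K`.
  have hsub : (B n + D) ∩ ((B n)ᶜ + D) + K ⊆ vanHoveBoundary (D + K) (B n) := by
    rintro _ ⟨a, ha, k, hk, rfl⟩
    refine mem_vanHoveBoundary (by rw [neg_add, hDs, hKs]) ?_ ?_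
    · rw [← add_assoc]; exact add_mem_add ha.1 hk
    · rw [← add_assoc]; exact add_mem_add ha.2 hk
  have hle := (measure_mono hsub).trans hn
  have hfin : mG ((B n + D) ∩ ((B n)ᶜ + D) + K) ≠ ⊤ := by
    refine ne_top_of_le_ne_top (hB.measure_add_ne_top hE n) (measure_mono ?_)
    rw [← add_assoc]
    exact add_subset_add_right inter_subset_left
  calc _ ≤ M * mG ((B n + D) ∩ ((B n)ᶜ + D) + K) := hM _ hfin x
    _ ≤ M * (δ / M * mG (B n)) := by gcongr
    _ = M * (δ / M) * mG (B n) := by ring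
    _ ≤ δ * mG (B n) := by gcongr; exact ENNReal.mul_div_le

theorem TranslationBounded.exists_eventually_add_le (hv : TranslationBounded v)
    (hB : IsVanHove mG B) {D : Set G} (hD : IsCompact D) {Q : Set H} (hQ : IsCompact Q) :
    ∃ M : ENNReal, M ≠ ⊤ ∧ ∀ᶠ n in atTop, ∀ x : G × H,
      ∫⁻ y, (B n + D).indicator 1 (y.1 + x.1) * Q.indicator 1 (y.2 + x.2) ∂v ≤ M * mG (B n) := by
  obtain ⟨K, hK, hK0, -⟩ := exists_symm_compact_nhds_zero (G := G)
  obtain ⟨M, hMt, hM⟩ := hv.exists_strip_bound (mG := mG) hK hK0 hQ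
  refine ⟨M * 2, ENNReal.mul_ne_top hMt (by simp), ?_⟩
  filter_upwards [hB.eventually_add_le (hD.add hK) one_ne_zero] with n hn x
  rw [← add_assoc, one_add_one_eq_two] at hn
  refine (hM _ (by rw [add_assoc]; exact hB.measure_add_ne_top (hD.add hK) n) x).trans ?_
  rw [mul_assoc]
  gcongr

end TranslationBounded

/-! ### Lattice points in strips, and the use of density -/

namespace CutProjectScheme

variable {G H : Type*} [AddCommGroup G] [TopologicalSpace G] [IsTopologicalAddGroup G]
  [LocallyCompactSpace G] [T2Space G]
  [AddCommGroup H] [TopologicalSpace H] [IsTopologicalAddGroup H]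
  [LocallyCompactSpace H] [T2Space H]
  (S : CutProjectScheme G H)

/-- The compactly supported function `|g|`, with complex values. -/
noncomputable def _root_.CompactlySupportedContinuousMap.normC {X : Type*} [TopologicalSpace X]
    (g : C_c(X, ℂ)) : C_c(X, ℂ) :=
  toComplex ⟨⟨fun x => ‖g x‖, (map_continuous g).norm⟩, g.hasCompactSupport.norm⟩

theorem _root_.CompactlySupportedContinuousMap.normC_apply {X : Type*} [TopologicalSpace X]
    (g : C_c(X, ℂ)) (x : X) : g.normC x = (‖g x‖ : ℂ) := rfl

theorem norm_shift_le (F : C(S.Torus, ℂ)) (ξ : S.Torus) : ‖S.shift F ξ‖ ≤ ‖F‖ :=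
  (ContinuousMap.norm_le _ (norm_nonneg _)).2 fun _ => F.norm_coe_le_norm _

/-- The sum of the unit masses at the points of the lattice. -/
noncomputable def latticeMeasure : @Measure (G × H) (borel (G × H)) :=
  Measure.sum fun l : S.lattice => @Measure.dirac _ (borel (G × H)) (l : G × H)

theorem lintegral_latticeMeasure (F : G × H → ENNReal) :
    ∫⁻ y, F y ∂S.latticeMeasure = ∑' l : S.lattice, F l := by
  have key : ∀ {X ι : Type _} [TopologicalSpace X] [T2Space X] (p : ι → X) (F : X → ENNReal),
      ∫⁻ y, F y ∂(Measure.sum fun l => @Measure.dirac _ (borel X) (p l)) = ∑' l, F (p l) := by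
    intro X ι _ _ p F
    let _ := borel X
    have : BorelSpace X := ⟨rfl⟩
    rw [lintegral_sum_measure]
    exact tsum_congr fun l => lintegral_dirac _ _
  exact key _ F

/-- The coset sum of `|g|` is continuous on the compact `𝕋`, hence bounded. The strip estimates for
measures thereby also count lattice points. -/
theorem translationBounded_latticeMeasure : TranslationBounded S.latticeMeasure := by
  intro g
  refine ⟨‖S.cosetSumMap g.normC‖, fun x => ?_⟩
  have h := (S.cosetSumMap g.normC).norm_coe_le_norm (QuotientAddGroup.mk x)
  rw [lintegral_latticeMeasure]
  have hs : Summable fun l : S.lattice => ‖g (x + l)‖ :=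
    summable_of_hasFiniteSupport ((S.finite_lattice_support g x).subset fun l hl => by
      simpa using hl)
  have h2 : S.cosetSumMap g.normC (QuotientAddGroup.mk x) =
      ((∑' l : S.lattice, ‖g (x + l)‖ : ℝ) : ℂ) := S.cosetSum_toComplex_mk _ x
  rw [h2, Complex.norm_real, Real.norm_of_nonneg (tsum_nonneg fun _ => norm_nonneg _)] at h
  refine le_trans (le_of_eq ?_) (ENNReal.ofReal_le_ofReal h)
  rw [ENNReal.ofReal_tsum_of_nonneg (fun _ => norm_nonneg _) hs]
  refine tsum_congr fun l => ?_
  rw [ofReal_norm, add_comm]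

/-- Density of the projection to `H` enters here: subtracting a suitable lattice point brings the
`H`-coordinate of any representative into `V`. So the images of the sets `(a + U) × V` cover `𝕋`,
and finitely many suffice. -/
theorem exists_compact_strip {V : Set H} (hV : V ∈ 𝓝 0) : ∃ C : Set G, IsCompact C ∧
    ∀ ξ : S.Torus, ∃ c ∈ C, ∃ v ∈ V, (QuotientAddGroup.mk (c, v) : S.Torus) = ξ := by
  obtain ⟨U, hU, hU0, -⟩ := exists_symm_compact_nhds_zero (G := G)
  have h0U : (0 : G) ∈ interior U := mem_interior_iff_mem_nhds.2 hU0
  have h0V : (0 : H) ∈ interior V := mem_interior_iff_mem_nhds.2 hV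
  obtain ⟨T, hT⟩ := isCompact_univ.elim_finite_subcover
    (fun a : G => (QuotientAddGroup.mk : G × H → S.Torus) '' ((a +ᵥ interior U) ×ˢ interior V))
    (fun a => QuotientAddGroup.isOpenMap_coe _ ((isOpen_interior.vadd a).prod isOpen_interior)) (by
      intro ξ _
      obtain ⟨⟨s, k⟩, rfl⟩ := QuotientAddGroup.mk_surjective ξ
      have hop : IsOpen {h : H | k - h ∈ interior V} :=
        isOpen_interior.preimage (continuous_const.sub continuous_id)
      obtain ⟨_, ⟨l, hlL, rfl⟩, hl⟩ := S.dense_snd.exists_mem_open hop ⟨k, by simpa using h0V⟩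
      refine mem_iUnion.2 ⟨s - l.1, (s - l.1, k - l.2), ⟨⟨0, h0U, by simp⟩, ?_⟩, ?_⟩
      · exact hl
      · rw [QuotientAddGroup.eq]
        convert! hlL using 1
        ext <;> simp)
  refine ⟨⋃ a ∈ T, a +ᵥ U, T.isCompact_biUnion fun a _ => hU.vadd a, fun ξ => ?_⟩
  obtain ⟨a, ha, ⟨c, v⟩, ⟨hc, hv⟩, rfl⟩ := mem_iUnion₂.1 (hT (mem_univ ξ))
  exact ⟨c, mem_iUnion₂.2 ⟨a, ha, vadd_set_mono interior_subset hc⟩, v, interior_subset hv, rfl⟩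

end CutProjectScheme

theorem norm_le_mul_measureReal {G E : Type*} [MeasurableSpace G] {mG : Measure G} {A : Set G}
    (hA : mG A ≠ ⊤) [NormedAddCommGroup E] {z : E} {η : ℝ} (hη : 0 ≤ η)
    (h : ‖z‖ₑ ≤ ENNReal.ofReal η * mG A) : ‖z‖ ≤ η * mG.real A := by
  rw [← ofReal_measureReal hA, ← ENNReal.ofReal_mul hη, ← ofReal_norm,
    ENNReal.ofReal_le_ofReal_iff (by positivity)] at h
  exact h

/-! ### Uniform convergence of normalised lattice sums -/

namespace CutProjectScheme

variable {G H : Type*} [AddCommGroup G] [TopologicalSpace G] [IsTopologicalAddGroup G]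
  [LocallyCompactSpace G] [T2Space G] [MeasurableSpace G] [BorelSpace G]
  [AddCommGroup H] [TopologicalSpace H] [IsTopologicalAddGroup H]
  [LocallyCompactSpace H] [T2Space H] [MeasurableSpace H] [BorelSpace H]
  (S : CutProjectScheme G H) {mG : Measure G} [mG.IsAddHaarMeasure] {B : ℕ → Set G}

/-- The lattice sums of `u n ⊗ f` oscillate little on the torus. -/
theorem eventually_osc_le (hB : IsVanHove mG B) {K : Set G} (hK : IsCompact K) (hK0 : 0 ∈ K)
    {u : ℕ → C_c(G, ℝ)} (hu1 : ∀ n, ∀ t ∈ B n, u n t = 1)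
    (hu0 : ∀ n t, t ∉ B n + K → u n t = 0) (hun : ∀ n t, 0 ≤ u n t) (hule : ∀ n t, u n t ≤ 1)
    (f : C_c(H, ℂ)) {η : ℝ} (hη : 0 < η) :
    ∀ᶠ n in atTop, ∀ ξ ζ : S.Torus,
      ‖S.cosetSum ((u n).toComplex.tensor f) ζ - S.cosetSum ((u n).toComplex.tensor f) ξ‖ ≤
        η * mG.real (B n) := by
  obtain ⟨Cf, hCf, hf⟩ := f.exists_norm_le
  obtain ⟨Q, hQ, hsQ, V₀, hV₀, hVQ, hunif⟩ := exists_nhds_norm_sub_le f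
  obtain ⟨M, hMt, hM⟩ := S.translationBounded_latticeMeasure.exists_eventually_add_le hB hK hQ
  obtain ⟨δ, hδ, hδM⟩ : ∃ δ : ℝ, 0 < δ ∧ ENNReal.ofReal δ * M ≤ ENNReal.ofReal (η / 2) := by
    refine ⟨η / 2 / (M.toReal + 1), by positivity, ?_⟩
    rw [← ENNReal.ofReal_toReal hMt, ← ENNReal.ofReal_mul (by positivity),
      ENNReal.toReal_ofReal ENNReal.toReal_nonneg]
    refine ENNReal.ofReal_le_ofReal ?_
    rw [div_mul_eq_mul_div, div_le_iff₀ (by positivity)]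
    have := ENNReal.toReal_nonneg (a := M)
    nlinarith
  obtain ⟨V, hV, hVV₀, hVf⟩ := hunif δ hδ
  obtain ⟨C, hC, hCs⟩ := S.exists_compact_strip hV
  -- `D` is symmetric and contains `K` and `K - C`: wherever translation by some `c ∈ C` changes `u
  -- n`, the point is `D`-close to `B n` and to its complement (`hAu`).
  let D₀ : Set G := K ∪ (K - C)
  have hD₀ : IsCompact D₀ := hK.union (by rw [sub_eq_add_neg]; exact hK.add hC.neg)
  let D : Set G := D₀ ∪ -D₀
  have hD : IsCompact D := hD₀.union hD₀.neg
  have hDs : -D = D := by simp only [D]; rw [Set.union_neg, neg_neg, union_comm]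
  have hKD : K ⊆ D := fun k hk => Or.inl (Or.inl hk)
  have hKCD : ∀ k ∈ K, ∀ c ∈ C, k - c ∈ D := fun k hk c hc => Or.inl (Or.inr ⟨k, hk, c, hc, rfl⟩)
  have hδ' : ENNReal.ofReal (η / 2 / Cf) ≠ 0 := by
    simp only [ne_eq, ENNReal.ofReal_eq_zero, not_le]
    positivity
  filter_upwards [hM, S.translationBounded_latticeMeasure.eventually_boundary_le hB hD hDs hQ hδ']
    with n hn1 hn2 ξ ζ
  set A : Set G := (B n + D) ∩ ((B n)ᶜ + D) with hA
  have hAu : ∀ c ∈ C, ∀ t, t ∉ A → u n (t + c) = u n t := by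
    intro c hc t ht
    by_contra hne
    refine ht ⟨?_, ?_⟩
    · by_cases htK : t ∈ B n + K
      · exact add_subset_add_left hKD htK
      · have htc : t + c ∈ B n + K := by
          by_contra h
          exact hne ((hu0 n _ h).trans (hu0 n _ htK).symm)
        obtain ⟨b, hb, k, hk, hbk⟩ := htc
        refine ⟨b, hb, k - c, hKCD k hk c hc, ?_⟩
        simp only at hbk ⊢
        rw [← add_sub_assoc, hbk, add_sub_cancel_right]
    · by_cases htB : t ∈ B n
      · have htc : t + c ∉ B n := fun h => hne ((hu1 n _ h).trans (hu1 n _ htB).symm)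
        exact ⟨t + c, htc, 0 - c, hKCD 0 hK0 c hc, by simp⟩
      · exact ⟨t, htB, 0, hKD hK0, by simp⟩
  obtain ⟨x, rfl⟩ := QuotientAddGroup.mk_surjective ξ
  obtain ⟨c, hc, v, hv, hcv⟩ := hCs (ζ - QuotientAddGroup.mk x)
  have hζ : ζ = QuotientAddGroup.mk (x + (c, v)) := by
    rw [QuotientAddGroup.mk_add, hcv, add_sub_cancel]
  rw [hζ, cosetSum_mk, cosetSum_mk, ← (S.summable_lattice _ _).tsum_sub (S.summable_lattice _ _)]
  refine norm_le_mul_measureReal (hB.measure_ne_top n) hη.le (enorm_tsum_le_tsum_enorm.trans ?_)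
  -- Product rule: `u` changes only over the layer `A`, where `f` is at most `Cf`; `f` changes by at
  -- most `δ`, over the base `B n + K`. Both terms live over `Q`.
  have hpt : ∀ l : S.lattice, ‖(u n).toComplex.tensor f (x + (c, v) + l) -
      (u n).toComplex.tensor f (x + l)‖ₑ ≤
      ENNReal.ofReal Cf * (A.indicator 1 ((l : G × H).1 + x.1) *
        Q.indicator 1 ((l : G × H).2 + x.2)) +
      ENNReal.ofReal δ * ((B n + K).indicator 1 ((l : G × H).1 + x.1) *
        Q.indicator 1 ((l : G × H).2 + x.2)) := by
    intro l
    have e : x + (c, v) + l = ((l : G × H).1 + x.1 + c, (l : G × H).2 + x.2 + v) := by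
      ext <;> simp <;> abel
    have e' : x + l = ((l : G × H).1 + x.1, (l : G × H).2 + x.2) := by
      ext <;> simp [add_comm]
    rw [e, e']
    generalize (l : G × H).1 + x.1 = t
    generalize (l : G × H).2 + x.2 = h
    simp only [tensor_apply, toComplex_apply]
    have h1 : ‖((u n (t + c) : ℂ) - u n t)‖ₑ ≤ A.indicator 1 t := by
      by_cases ht : t ∈ A
      · rw [indicator_of_mem ht, Pi.one_apply, ← ofReal_norm, ← ENNReal.ofReal_one]
        refine ENNReal.ofReal_le_ofReal ?_
        rw [← Complex.ofReal_sub, Complex.norm_real, Real.norm_eq_abs, abs_le]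
        constructor <;> linarith [hun n t, hun n (t + c), hule n t, hule n (t + c)]
      · simp [hAu c hc t ht]
    have h2 : ‖f (h + v)‖ₑ ≤ ENNReal.ofReal Cf * Q.indicator 1 h := by
      by_cases hh : h ∈ Q
      · rw [indicator_of_mem hh, Pi.one_apply, mul_one, ← ofReal_norm]
        exact ENNReal.ofReal_le_ofReal (hf _)
      · have : f (h + v) = 0 := by
          by_contra hne
          exact hh (hVQ v (hVV₀ hv) h hne)
        simp [this]
    have h3 : ‖(u n t : ℂ)‖ₑ ≤ (B n + K).indicator 1 t := by
      by_cases ht : t ∈ B n + K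
      · rw [indicator_of_mem ht, Pi.one_apply, ← ofReal_norm, ← ENNReal.ofReal_one]
        refine ENNReal.ofReal_le_ofReal ?_
        rw [Complex.norm_real, Real.norm_of_nonneg (hun n t)]
        exact hule n t
      · simp [hu0 n t ht]
    have h4 : ‖f (h + v) - f h‖ₑ ≤ ENNReal.ofReal δ * Q.indicator 1 h := by
      by_cases hh : h ∈ Q
      · rw [indicator_of_mem hh, Pi.one_apply, mul_one, ← ofReal_norm]
        exact ENNReal.ofReal_le_ofReal (hVf v hv h)
      · have h5 : f (h + v) = 0 := by
          by_contra hne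
          exact hh (hVQ v (hVV₀ hv) h hne)
        have h6 : f h = 0 := by
          by_contra hne
          exact hh (hsQ (subset_tsupport _ hne))
        simp [h5, h6]
    calc _ = ‖((u n (t + c) : ℂ) - u n t) * f (h + v) + (u n t : ℂ) * (f (h + v) - f h)‖ₑ := by
          congr 1; ring
      _ ≤ ‖((u n (t + c) : ℂ) - u n t)‖ₑ * ‖f (h + v)‖ₑ + ‖(u n t : ℂ)‖ₑ * ‖f (h + v) - f h‖ₑ := by
          rw [← enorm_mul, ← enorm_mul]
          exact enorm_add_le _ _
      _ ≤ A.indicator 1 t * (ENNReal.ofReal Cf * Q.indicator 1 h) +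
          (B n + K).indicator 1 t * (ENNReal.ofReal δ * Q.indicator 1 h) := by gcongr
      _ = _ := by ring
  have k1 := hn1 x
  have k2 := hn2 x
  rw [lintegral_latticeMeasure] at k1 k2
  calc _ ≤ _ := ENNReal.tsum_le_tsum hpt
    _ ≤ ENNReal.ofReal Cf * (ENNReal.ofReal (η / 2 / Cf) * mG (B n)) +
        ENNReal.ofReal δ * (M * mG (B n)) := by
      rw [ENNReal.tsum_add, ENNReal.tsum_mul_left, ENNReal.tsum_mul_left]
      gcongr
    _ ≤ ENNReal.ofReal (η / 2) * mG (B n) + ENNReal.ofReal (η / 2) * mG (B n) := by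
      rw [← mul_assoc, ← mul_assoc, ← ENNReal.ofReal_mul hCf.le, mul_div_cancel₀ _ hCf.ne']
      gcongr
    _ = ENNReal.ofReal η * mG (B n) := by
      rw [← add_mul, ← ENNReal.ofReal_add (by positivity) (by positivity), add_halves]

theorem eventually_integral_cutoff_le (hB : IsVanHove mG B) {K : Set G} (hK : IsCompact K)
    {u : ℕ → C_c(G, ℝ)} (hu1 : ∀ n, ∀ t ∈ B n, u n t = 1)
    (hu0 : ∀ n t, t ∉ B n + K → u n t = 0) (hun : ∀ n t, 0 ≤ u n t) (hule : ∀ n t, u n t ≤ 1)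
    {η : ℝ} (hη : 0 < η) :
    ∀ᶠ n in atTop, |∫ t, u n t ∂mG - mG.real (B n)| ≤ η * mG.real (B n) := by
  filter_upwards [hB.eventually_add_le hK (δ := ENNReal.ofReal η) (by simpa using hη)] with n hn
  have hui : Integrable (u n) mG :=
    (map_continuous (u n)).integrable_of_hasCompactSupport (u n).hasCompactSupport
  have h1 : mG.real (B n) ≤ ∫ t, u n t ∂mG := by
    rw [← integral_indicator_one (hB.measurableSet n)]
    refine integral_mono ((integrable_indicator_iff (hB.measurableSet n)).2
      (integrableOn_const (hB.measure_ne_top n))) hui fun t => ?_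
    by_cases ht : t ∈ B n
    · simp [ht, hu1 n t ht]
    · simp [ht, hun n t]
  have h2 : ENNReal.ofReal (∫ t, u n t ∂mG) ≤ ENNReal.ofReal ((1 + η) * mG.real (B n)) := by
    rw [ofReal_integral_eq_lintegral_ofReal hui (ae_of_all _ (hun n)),
      ENNReal.ofReal_mul (by positivity), ofReal_measureReal (hB.measure_ne_top n),
      ENNReal.ofReal_add zero_le_one hη.le, ENNReal.ofReal_one]
    refine ((lintegral_mono fun t => ?_).trans (lintegral_indicator_one_le (B n + K))).trans hn
    by_cases ht : t ∈ B n + K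
    · rw [indicator_of_mem ht]
      simpa using hule n t
    · simp [hu0 n t ht]
  rw [ENNReal.ofReal_le_ofReal_iff (by positivity)] at h2
  rw [abs_le]
  constructor <;> nlinarith [measureReal_nonneg (μ := mG) (s := B n)]

variable {mH : Measure H} [mH.IsAddHaarMeasure] {S}

/-- The lattice sums of `u n ⊗ f`, divided by the measure of `B n`, converge uniformly. -/
theorem eventually_norm_cosetSumMap_sub_le {mT : C(S.Torus, ℂ) →L[ℂ] ℂ}
    (hmT : S.IsDisintegration (prodFunctional mG mH) mT)
    (hB : IsVanHove mG B) {K : Set G} (hK : IsCompact K) (hK0 : 0 ∈ K)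
    {u : ℕ → C_c(G, ℝ)} (hu1 : ∀ n, ∀ t ∈ B n, u n t = 1)
    (hu0 : ∀ n t, t ∉ B n + K → u n t = 0) (hun : ∀ n t, 0 ≤ u n t) (hule : ∀ n t, u n t ≤ 1)
    (f : C_c(H, ℂ)) {ε : ℝ} (hε : 0 < ε) :
    ∀ᶠ n in atTop, ‖S.cosetSumMap ((u n).toComplex.tensor f) -
      ((mG.real (B n) : ℂ) * (∫ h, f h ∂mH) / mT 1) • (1 : C(S.Torus, ℂ))‖ ≤
        ε * mG.real (B n) := by
  set I : ℂ := ∫ h, f h ∂mH with hI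
  have hmT1 := haar_one_ne_zero hmT
  have hpos : 0 < ‖mT 1‖ := norm_pos_iff.2 hmT1
  -- `η` pays for the oscillation of `F`, again (times `‖mT‖`) for that oscillation integrated
  -- against Haar measure, and (times `‖I‖`) for `∫ u n` against `m_G(B n)`.
  obtain ⟨η, hη, hηε⟩ : ∃ η : ℝ, 0 < η ∧ η + (‖mT‖ * η + ‖I‖ * η) / ‖mT 1‖ ≤ ε := by
    refine ⟨ε / (1 + (‖mT‖ + ‖I‖) / ‖mT 1‖), by positivity, le_of_eq ?_⟩
    have : (1 + (‖mT‖ + ‖I‖) / ‖mT 1‖) ≠ 0 := by positivity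
    field_simp
  filter_upwards [S.eventually_osc_le hB hK hK0 hu1 hu0 hun hule f hη,
    eventually_integral_cutoff_le hB hK hu1 hu0 hun hule hη] with n hosc hint
  set F := S.cosetSumMap ((u n).toComplex.tensor f) with hF
  set m : ℝ := mG.real (B n) with hm
  have hm0 : 0 ≤ m := measureReal_nonneg
  -- As `F` is almost the constant `F 0`, applying `mT` determines this constant up to small errors.
  set a : ℂ := F 0 with ha
  have h1 : ‖F - a • (1 : C(S.Torus, ℂ))‖ ≤ η * m :=
    (ContinuousMap.norm_le _ (by positivity)).2 fun ξ => by
      simpa [hF, ha] using hosc 0 ξ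
  have h2 : mT F = ((∫ t, u n t ∂mG : ℝ) : ℂ) * I := by
    rw [hF, ← hmT, prodFunctional_tensor, hI]
    congr 1
    exact integral_complex_ofReal
  have h3 : ‖mT F - a * mT 1‖ ≤ ‖mT‖ * (η * m) := by
    have : mT F - a * mT 1 = mT (F - a • (1 : C(S.Torus, ℂ))) := by
      rw [map_sub, map_smul, smul_eq_mul]
    rw [this]
    exact (mT.le_opNorm _).trans (by gcongr)
  have h4 : ‖mT F - m * I‖ ≤ η * m * ‖I‖ := by
    rw [h2, ← sub_mul, norm_mul, ← Complex.ofReal_sub, Complex.norm_real, Real.norm_eq_abs]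
    gcongr
  have h5 : ‖a - m * I / mT 1‖ ≤ (‖mT‖ * η + ‖I‖ * η) / ‖mT 1‖ * m := by
    have : a - m * I / mT 1 = ((mT F - m * I) - (mT F - a * mT 1)) / mT 1 := by
      field_simp
      ring
    rw [this, norm_div, div_mul_eq_mul_div]
    gcongr
    refine (norm_sub_le _ _).trans ((add_le_add h4 h3).trans_eq (by ring))
  have h6 : F - (m * I / mT 1) • (1 : C(S.Torus, ℂ)) =
      (F - a • (1 : C(S.Torus, ℂ))) + (a - m * I / mT 1) • (1 : C(S.Torus, ℂ)) := by
    rw [sub_smul]; abel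
  have h7 : ‖(1 : C(S.Torus, ℂ))‖ ≤ 1 :=
    (ContinuousMap.norm_le _ zero_le_one).2 fun ξ => by simp
  rw [h6]
  calc _ ≤ η * m + (‖mT‖ * η + ‖I‖ * η) / ‖mT 1‖ * m * 1 := by
        refine (norm_add_le _ _).trans (add_le_add h1 ?_)
        rw [norm_smul]
        gcongr
    _ = (η + (‖mT‖ * η + ‖I‖ * η) / ‖mT 1‖) * m := by ring
    _ ≤ ε * m := by gcongr

end CutProjectScheme

/-! ### Disintegration and translation boundedness of `ρ` -/

section Radon

variable {G H : Type*} [AddCommGroup G] [TopologicalSpace G] [IsTopologicalAddGroup G]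
  [LocallyCompactSpace G] [SigmaCompactSpace G] [T2Space G]
  [AddCommGroup H] [TopologicalSpace H] [IsTopologicalAddGroup H]
  [LocallyCompactSpace H] [SigmaCompactSpace H] [T2Space H]
  {S : CutProjectScheme G H} {ρ : ComplexRadonMeasure (G × H)}

theorem CutProjectScheme.existsUnique_radon (hρ : ρ.IsInvariant S.lattice) :
    ∃! ρT : C(S.Torus, ℂ) →L[ℂ] ℂ, S.IsDisintegration (fun g => ρ.integral g) ρT :=
  S.existsUnique_isDisintegration ρ.toLinearMap (fun l hl g => hρ l hl g)
    fun w => ⟨_, fun F a ha => ρ.cmul_bound w F a ha⟩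

theorem CutProjectScheme.IsDisintegration.integral_add_right {ρT : C(S.Torus, ℂ) →L[ℂ] ℂ}
    (hρT : S.IsDisintegration (fun g => ρ.integral g) ρT) (g : C_c(G × H, ℂ)) (x : G × H) :
    ρ.integral (fun y => g (y + x)) = ρT (S.shift (S.cosetSumMap g) (QuotientAddGroup.mk x)) := by
  rw [← S.cosetSumMap_transl]
  exact hρT (g.transl x)

/-- `|ρ|` is invariant too, so it disintegrates through some `J`; the integral of `|g|(· + x)` is
`J` of a translate of `σ(|g|)`, whose norm does not depend on `x`. -/
theorem ComplexRadonMeasure.IsInvariant.translationBounded (hρ : ρ.IsInvariant S.lattice) :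
    TranslationBounded ρ.variation := by
  intro g
  obtain ⟨J, hJ, -⟩ := CutProjectScheme.existsUnique_radon hρ.abs
  refine ⟨‖J‖ * ‖S.cosetSumMap g.normC‖, fun x => ?_⟩
  have h := hJ.integral_add_right g.normC x
  simp only [ρ.abs_integral, normC_apply] at h
  refine (ofReal_integral_norm_eq_lintegral_enorm (ρ.integrable_cc (g.transl x))).symm.le.trans
    (ENNReal.ofReal_le_ofReal ?_)
  have h2 : ((∫ y, ‖g.transl x y‖ ∂ρ.variation : ℝ) : ℂ) =
      J (S.shift (S.cosetSumMap g.normC) (QuotientAddGroup.mk x)) := by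
    rw [← h]
    exact (ρ.integral_variation_ofReal _).symm
  calc _ ≤ ‖((∫ y, ‖g.transl x y‖ ∂ρ.variation : ℝ) : ℂ)‖ := by
        rw [Complex.norm_real]; exact le_abs_self _
    _ ≤ ‖J‖ * ‖S.shift (S.cosetSumMap g.normC) (QuotientAddGroup.mk x)‖ := by
        rw [h2]; exact J.le_opNorm _
    _ ≤ _ := by gcongr; exact S.norm_shift_le _ _

/-- If `J 1 = 0`, the weight `w ≥ 0` has `|ρ|`-integral `0`. Then `J F = |ρ|((F ∘ π) w)` vanishes
for all `F`, so `|ρ|` vanishes on every `|g|`. -/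
theorem CutProjectScheme.IsDisintegration.abs_one_ne_zero {J : C(S.Torus, ℂ) →L[ℂ] ℂ}
    (hJ : S.IsDisintegration (fun g => ρ.abs.integral g) J) (h0 : ρ.variation ≠ 0) : J 1 ≠ 0 := by
  intro hJ1
  obtain ⟨w, hw0, hw⟩ := S.exists_weight
  refine h0 (ρ.variation_eq_zero_of_integral_norm_eq_zero fun g => ?_)
  have h1 : ∫ y, ‖w.toComplex y‖ ∂ρ.variation = 0 := by
    rw [hJ.apply_one hw, ρ.abs_integral] at hJ1
    have : ∫ y, w.toComplex y ∂ρ.variation = ((∫ y, ‖w.toComplex y‖ ∂ρ.variation : ℝ) : ℂ) := by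
      refine Eq.trans ?_ (ρ.integral_variation_ofReal _)
      congr 1 with y
      rw [toComplex_apply, Complex.norm_real, Real.norm_of_nonneg (hw0 y)]
    rw [this] at hJ1
    exact_mod_cast hJ1
  have h2 : ρ.abs.integral g.normC = _ := hJ g.normC
  rw [hJ.apply_eq _ hw] at h2
  have h3 := ρ.abs.cmul_bound w.toComplex (S.lift (S.cosetSumMap g.normC)) _
    fun x => (S.cosetSumMap g.normC).norm_coe_le_norm _
  rw [← h2, ρ.abs_variation, h1, zero_mul, ρ.abs_integral] at h3
  have h4 : ∫ y, g.normC y ∂ρ.variation = ((∫ y, ‖g y‖ ∂ρ.variation : ℝ) : ℂ) :=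
    ρ.integral_variation_ofReal _
  rw [h4] at h3
  exact_mod_cast norm_le_zero_iff.1 h3

end Radon

/-! ### Convergence for `C_c(H)`, and passage to limits -/

section Weyl

variable {G H : Type*} [AddCommGroup G] [TopologicalSpace G] [IsTopologicalAddGroup G]
  [LocallyCompactSpace G] [SigmaCompactSpace G] [T2Space G] [MeasurableSpace G] [BorelSpace G]
  [AddCommGroup H] [TopologicalSpace H] [IsTopologicalAddGroup H]
  [LocallyCompactSpace H] [SigmaCompactSpace H] [T2Space H] [MeasurableSpace H] [BorelSpace H]
  {S : CutProjectScheme G H} {ρ : ComplexRadonMeasure (G × H)}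
  {mG : Measure G} [mG.IsAddHaarMeasure] {mH : Measure H} [mH.IsAddHaarMeasure]
  {B : ℕ → Set G} {ρT mT : C(S.Torus, ℂ) →L[ℂ] ℂ}

theorem muIntegrand_add (f : H → ℂ) (A : Set G) (x l y : G × H) :
    muIntegrand f A (x + l) y = muIntegrand f A x (y + l) := by
  simp only [muIntegrand, Prod.fst_add, Prod.snd_add]
  rw [add_right_comm y.2, add_right_comm y.1, ← add_assoc, ← add_assoc]

theorem enorm_muIntegrand (f : H → ℂ) (A : Set G) (x y : G × H) :
    ‖muIntegrand f A x y‖ₑ = A.indicator 1 (y.1 + x.1) * ‖f (y.2 + x.2)‖ₑ := by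
  rw [muIntegrand, enorm_mul, mul_comm]
  by_cases h : y.1 + x.1 ∈ A <;> simp [h]

theorem aestronglyMeasurable_muIntegrand {f : H → ℂ} {A : Set G} (hA : MeasurableSet A)
    {x : G × H}
    (hf : AEStronglyMeasurable[borel (G × H)] (fun y : G × H => f (y.2 + x.2)) ρ.variation) :
    AEStronglyMeasurable[borel (G × H)] (muIntegrand f A x) ρ.variation := by
  refine hf.mul (Measurable.aestronglyMeasurable ?_)
  exact (measurable_one.indicator hA).comp
    (by fun_prop : Continuous fun y : G × H => y.1 + x.1).measurable_of_borel

theorem aestronglyMeasurable_snd_add {f : H → ℂ} (hf : Measurable f) (k : H) :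
    AEStronglyMeasurable[borel (G × H)] (fun y : G × H => f (y.2 + k)) ρ.variation :=
  (hf.comp
    (by fun_prop : Continuous fun y : G × H => y.2 + k).measurable_of_borel).aestronglyMeasurable

theorem enorm_le_indicator_tsupport (f : C_c(H, ℂ)) {C : ℝ} (hC : ∀ h, ‖f h‖ ≤ C) (h : H) :
    ‖f h‖ₑ ≤ ENNReal.ofReal C * (tsupport f).indicator 1 h := by
  by_cases hh : h ∈ tsupport f
  · rw [indicator_of_mem hh, Pi.one_apply, mul_one, ← ofReal_norm]
    exact ENNReal.ofReal_le_ofReal (hC _)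
  · simp [image_eq_zero_of_notMem_tsupport hh]

theorem integrable_muIntegrand (hρ : ρ.IsInvariant S.lattice) (hB : IsVanHove mG B)
    (f : C_c(H, ℂ)) (n : ℕ) (x : G × H) : Integrable (muIntegrand f (B n) x) ρ.variation := by
  refine ⟨aestronglyMeasurable_muIntegrand (hB.measurableSet n)
    (aestronglyMeasurable_snd_add (map_continuous f).measurable _), ?_⟩
  obtain ⟨C, hC, hf⟩ := f.exists_norm_le
  obtain ⟨K, hK, hK0, -⟩ := exists_symm_compact_nhds_zero (G := G)
  obtain ⟨M, hMt, hM⟩ := hρ.translationBounded.exists_strip_bound (mG := mG) hK hK0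
    f.hasCompactSupport.isCompact
  have hfin := hB.measure_add_ne_top hK n
  calc _ ≤ ∫⁻ y, ENNReal.ofReal C * ((B n).indicator 1 (y.1 + x.1) *
        (tsupport f).indicator 1 (y.2 + x.2)) ∂ρ.variation := by
        refine lintegral_mono fun y => ?_
        rw [enorm_muIntegrand, mul_left_comm]
        gcongr
        exact enorm_le_indicator_tsupport f hf _
    _ ≤ ENNReal.ofReal C * (M * mG (B n + K)) := by
        rw [lintegral_const_mul' _ _ ENNReal.ofReal_ne_top]
        gcongr
        exact hM _ hfin x
    _ < ⊤ := ENNReal.mul_lt_top ENNReal.ofReal_lt_top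
        (ENNReal.mul_lt_top hMt.lt_top hfin.lt_top)

/-- Half of `ε` pays for `ρ_𝕋` applied to a translate of the nearly constant lattice sum of `u n ⊗
f`, the other half for replacing `u n` by the indicator of `B n`, which matters only over a boundary
layer. -/
theorem eventually_norm_integral_sub_le (hρ : ρ.IsInvariant S.lattice)
    (hρT : S.IsDisintegration (fun g => ρ.integral g) ρT)
    (hmT : S.IsDisintegration (prodFunctional mG mH) mT) (hB : IsVanHove mG B)
    (f : C_c(H, ℂ)) {ε : ℝ} (hε : 0 < ε) :
    ∀ᶠ n in atTop, ∀ x : G × H, ‖ρ.integral (muIntegrand f (B n) x) -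
      (mG.real (B n) : ℂ) * (ρT 1 / mT 1 * ∫ h, f h ∂mH)‖ ≤ ε * mG.real (B n) := by
  obtain ⟨K, hK, hKn, hKs⟩ := exists_symm_compact_nhds_zero (G := G)
  have hK0 : (0 : G) ∈ K := mem_of_mem_nhds hKn
  choose u hu1 hu0 hun hule using fun n => exists_cutoff_add hKn (hB.relCompact n)
  obtain ⟨C, hC, hf⟩ := f.exists_norm_le
  have hε₁ : 0 < ε / 2 / (‖ρT‖ + 1) := by positivity
  have hε₂ : ENNReal.ofReal (ε / 2 / C) ≠ 0 := by
    simp only [ne_eq, ENNReal.ofReal_eq_zero, not_le]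
    positivity
  filter_upwards [CutProjectScheme.eventually_norm_cosetSumMap_sub_le hmT hB hK hK0 hu1 hu0 hun
    hule f hε₁, hρ.translationBounded.eventually_boundary_le hB hK hKs
    f.hasCompactSupport.isCompact hε₂] with n hn1 hn2 x
  set g := (u n).toComplex.tensor f with hg
  set m : ℝ := mG.real (B n) with hm
  have hm0 : 0 ≤ m := measureReal_nonneg
  set a : ℂ := (m : ℂ) * (∫ h, f h ∂mH) / mT 1 with ha
  have h1 : ‖ρ.integral (fun y => g (y + x)) - a * ρT 1‖ ≤ ε / 2 * m := by
    rw [hρT.integral_add_right]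
    have e1 : ρT (S.shift (S.cosetSumMap g) (QuotientAddGroup.mk x)) - a * ρT 1 =
        ρT (S.shift (S.cosetSumMap g - a • 1) (QuotientAddGroup.mk x)) := by
      have : S.shift (S.cosetSumMap g - a • 1) (QuotientAddGroup.mk x) =
          S.shift (S.cosetSumMap g) (QuotientAddGroup.mk x) - a • 1 := by
        ext ξ; simp
      rw [this, map_sub, map_smul, smul_eq_mul]
    rw [e1]
    calc _ ≤ ‖ρT‖ * (ε / 2 / (‖ρT‖ + 1) * m) := by
          refine (ρT.le_opNorm _).trans ?_
          gcongr
          exact (S.norm_shift_le _ _).trans hn1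
      _ ≤ (‖ρT‖ + 1) * (ε / 2 / (‖ρT‖ + 1) * m) := by gcongr; linarith
      _ = ε / 2 * m := by field_simp
  have h2 : ‖ρ.integral (muIntegrand f (B n) x) - ρ.integral (fun y => g (y + x))‖ ≤
      ε / 2 * m := by
    have e0 := ρ.integral_sub (integrable_muIntegrand hρ hB f n x) (ρ.integrable_cc (g.transl x))
    refine e0 ▸ norm_le_mul_measureReal (hB.measure_ne_top n) (by positivity)
      ((ρ.enorm_integral_le _).trans ?_)
    calc _ ≤ ∫⁻ y, ENNReal.ofReal C * (((B n + K) ∩ ((B n)ᶜ + K)).indicator 1 (y.1 + x.1) *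
          (tsupport f).indicator 1 (y.2 + x.2)) ∂ρ.variation := by
          refine lintegral_mono fun y => ?_
          have e : muIntegrand f (B n) x y - g (y + x) =
              f (y.2 + x.2) * ((B n).indicator 1 (y.1 + x.1) - (u n (y.1 + x.1) : ℂ)) := by
            simp only [muIntegrand, hg, tensor_apply, toComplex_apply, Prod.fst_add, Prod.snd_add]
            ring
          change ‖muIntegrand f (B n) x y - g (y + x)‖ₑ ≤ _
          rw [e, enorm_mul]
          generalize y.1 + x.1 = t
          rw [mul_left_comm, mul_comm]
          gcongr
          · by_cases ht : t ∈ B n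
            · simp [ht, hu1 n t ht]
            · by_cases htK : t ∈ B n + K
              · have htA : t ∈ (B n + K) ∩ ((B n)ᶜ + K) := ⟨htK, ⟨t, ht, 0, hK0, by simp⟩⟩
                rw [indicator_of_mem htA, indicator_of_notMem ht, zero_sub, enorm_neg,
                  Pi.one_apply, ← ofReal_norm, ← ENNReal.ofReal_one, Complex.norm_real,
                  Real.norm_of_nonneg (hun n t)]
                exact ENNReal.ofReal_le_ofReal (hule n t)
              · simp [ht, hu0 n t htK]
          · exact enorm_le_indicator_tsupport f hf _
      _ ≤ ENNReal.ofReal C * (ENNReal.ofReal (ε / 2 / C) * mG (B n)) := by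
          rw [lintegral_const_mul' _ _ ENNReal.ofReal_ne_top]
          gcongr
          exact hn2 x
      _ = ENNReal.ofReal (ε / 2) * mG (B n) := by
          rw [← mul_assoc, ← ENNReal.ofReal_mul hC.le, mul_div_cancel₀ _ hC.ne']
  have h3 : (m : ℂ) * (ρT 1 / mT 1 * ∫ h, f h ∂mH) = a * ρT 1 := by
    rw [ha]; ring
  rw [h3]
  calc _ ≤ ε / 2 * m + ε / 2 * m :=
        (norm_sub_le_norm_sub_add_norm_sub _ _ _).trans (add_le_add h2 h1)
    _ = ε * m := by ring

/-- Uniform convergence of averages passes to functions that are approximated by functions in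
`C_c(H)`, in mean with respect to `|ρ|`. -/
theorem weylConvergence_of_approx (hρ : ρ.IsInvariant S.lattice)
    (hρT : S.IsDisintegration (fun g => ρ.integral g) ρT)
    (hmT : S.IsDisintegration (prodFunctional mG mH) mT) {f : H → ℂ} {c : ℂ}
    (hint : ∀ B, IsVanHove mG B → ∀ n x, Integrable (muIntegrand f (B n) x) ρ.variation)
    (happ : ∀ B, IsVanHove mG B → ∀ ε : ℝ, 0 < ε → ∃ φ : C_c(H, ℂ), ‖∫ h, φ h ∂mH - c‖ ≤ ε ∧
      ∀ᶠ n in atTop, ∀ x, ∫⁻ y, ‖muIntegrand f (B n) x y - muIntegrand φ (B n) x y‖ₑ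
        ∂ρ.variation ≤ ENNReal.ofReal ε * mG (B n)) :
    WeylConvergence mG S ρ f (ρT 1 / mT 1 * c) := by
  intro B hB
  -- `μ` is defined through a chosen representative of `ξ`; invariance of `ρ` on integrable
  -- functions makes the choice irrelevant.
  refine ⟨hint B hB, fun n ξ => ρ.integral (muIntegrand f (B n) ξ.out), fun n x => ?_, ?_⟩
  · obtain ⟨l, hl⟩ := QuotientAddGroup.mk_out_eq_add S.lattice x
    simp only [hl]
    simp_rw [funext (muIntegrand_add f (B n) x l)]
    exact hρ.integral_add_right l.2 (hint B hB n x)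
  · rw [Metric.tendstoUniformly_iff]
    intro ε hε
    set q : ℂ := ρT 1 / mT 1 with hq
    -- Three errors: `f` against `φ` in `|ρ|`-mean, the convergence for `φ`, and `∫ φ` against `c`,
    -- multiplied by `q`.
    obtain ⟨η, hη, hηε⟩ : ∃ η : ℝ, 0 < η ∧ η + η + ‖q‖ * η < ε := by
      refine ⟨ε / 2 / (2 + ‖q‖), by positivity, ?_⟩
      have : ε / 2 / (2 + ‖q‖) + ε / 2 / (2 + ‖q‖) + ‖q‖ * (ε / 2 / (2 + ‖q‖)) = ε / 2 := by
        field_simp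
        ring
      linarith
    obtain ⟨φ, hφc, hφ⟩ := happ B hB η hη
    filter_upwards [hφ, eventually_norm_integral_sub_le hρ hρT hmT hB φ hη] with n hn1 hn2 ξ
    generalize ξ.out = x
    set m : ℝ := mG.real (B n) with hm
    have hm0 : 0 < m := ENNReal.toReal_pos (hB.pos n).ne' (hB.measure_ne_top n)
    have hmc : (m : ℂ) ≠ 0 := Complex.ofReal_ne_zero.2 hm0.ne'
    have h1 : ‖ρ.integral (muIntegrand f (B n) x) - ρ.integral (muIntegrand φ (B n) x)‖ ≤
        η * m := by
      rw [← ρ.integral_sub (hint B hB n x) (integrable_muIntegrand hρ hB φ n x)]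
      exact norm_le_mul_measureReal (hB.measure_ne_top n) hη.le
        ((ρ.enorm_integral_le _).trans (hn1 x))
    have h2 : ‖(m : ℂ) * (q * ∫ h, φ h ∂mH) - m * (q * c)‖ ≤ m * (‖q‖ * η) := by
      rw [← mul_sub, ← mul_sub, norm_mul, norm_mul, Complex.norm_real, Real.norm_of_nonneg hm0.le]
      gcongr
    have h3 : ‖ρ.integral (muIntegrand f (B n) x) - m * (q * c)‖ ≤ (η + η + ‖q‖ * η) * m := by
      calc _ ≤ η * m + (η * m + m * (‖q‖ * η)) :=
            (norm_sub_le_norm_sub_add_norm_sub _ _ _).trans (add_le_add h1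
              ((norm_sub_le_norm_sub_add_norm_sub _ _ _).trans (add_le_add (hn2 x) h2)))
        _ = _ := by ring
    rw [dist_comm, dist_eq_norm]
    have h4 : ρ.integral (muIntegrand f (B n) x) / m - q * c =
        (ρ.integral (muIntegrand f (B n) x) - m * (q * c)) / m := by
      field_simp
    rw [h4, norm_div, Complex.norm_real, Real.norm_of_nonneg hm0.le, div_lt_iff₀ hm0]
    exact h3.trans_lt (by gcongr)

theorem weylConvergence_cc (hρ : ρ.IsInvariant S.lattice)
    (hρT : S.IsDisintegration (fun g => ρ.integral g) ρT)
    (hmT : S.IsDisintegration (prodFunctional mG mH) mT) (f : C_c(H, ℂ)) :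
    WeylConvergence mG S ρ f (ρT 1 / mT 1 * ∫ h, f h ∂mH) :=
  weylConvergence_of_approx hρ hρT hmT (fun _ hB => integrable_muIntegrand hρ hB f)
    fun B hB ε hε => ⟨f, by simpa using hε.le, by simp⟩

end Weyl

/-! ### Continuous admissible functions -/

section Admissible

variable {G H : Type*} [AddCommGroup G] [TopologicalSpace G] [IsTopologicalAddGroup G]
  [LocallyCompactSpace G] [SigmaCompactSpace G] [T2Space G] [MeasurableSpace G] [BorelSpace G]
  [AddCommGroup H] [TopologicalSpace H] [IsTopologicalAddGroup H]
  [LocallyCompactSpace H] [SigmaCompactSpace H] [T2Space H] [MeasurableSpace H] [BorelSpace H]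
  {S : CutProjectScheme G H} {ρ : ComplexRadonMeasure (G × H)}
  {mG : Measure G} [mG.IsAddHaarMeasure] {mH : Measure H} [mH.IsAddHaarMeasure]
  {ρT mT : C(S.Torus, ℂ) →L[ℂ] ℂ}

theorem weylConvergence_of_variation_eq_zero (h0 : ρ.variation = 0)
    (hρT : S.IsDisintegration (fun g => ρ.integral g) ρT) (f : H → ℂ) (c : ℂ) :
    WeylConvergence mG S ρ f (ρT 1 / mT 1 * c) := by
  have hint : ∀ F : G × H → ℂ, ρ.integral F = 0 := fun F => by
    rw [ComplexRadonMeasure.integral, h0, integral_zero_measure]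
  have hρ1 : ρT 1 = 0 := by
    obtain ⟨w, -, hw⟩ := S.exists_weight
    rw [hρT.apply_one hw, hint]
  intro B hB
  refine ⟨fun n x => ?_, fun _ _ => 0, fun n x => (hint _).symm, ?_⟩
  · rw [ComplexRadonMeasure.IntegrableFun, h0]
    exact integrable_zero_measure
  · rw [hρ1, Metric.tendstoUniformly_iff]
    intro ε hε
    simp [hε]

/-- A uniform bound for the integrals of `f` over the strips `φ (t + s) 1_{Qᶜ} (h + k)` bounds the
tail of the integral of `f` with respect to Haar measure. -/
theorem lintegral_tail_le {J : C(S.Torus, ℂ) →L[ℂ] ℂ}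
    (hJ : S.IsDisintegration (fun g => ρ.abs.integral g) J) (hJ1 : J 1 ≠ 0)
    (hmT : S.IsDisintegration (prodFunctional mG mH) mT) {f : H → ℂ} (hf : Continuous f)
    {φ : C_c(G, ℝ)} (hφI : 0 < ∫ t, φ t ∂mG)
    {Q : Set H} {ε : ℝ} (hε : 0 ≤ ε)
    (htight : ∀ (s : G) (k : H), ∫⁻ y, ‖φ.toComplex (y.1 + s) * f (y.2 + k)‖ₑ *
      Qᶜ.indicator 1 (y.2 + k) ∂ρ.variation ≤ ENNReal.ofReal ε)
    {θ : C_c(H, ℝ)} (hθ1 : ∀ h ∈ Q, θ h = 1) (hθn : ∀ h, 0 ≤ θ h) (hθle : ∀ h, θ h ≤ 1) :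
    ∫⁻ h, ‖f h - f h * θ h‖ₑ ∂mH ≤
      ENNReal.ofReal (‖mT‖ / (‖J 1‖ * ∫ t, φ t ∂mG) * ε) := by
  -- The factor `κ` makes the tail `f (1 - θ)` compactly supported, so that it can be averaged over
  -- `𝕋`. The bound does not depend on `κ`, which is removed by exhausting `H` with compact sets.
  have key : ∀ κ : C_c(H, ℝ), (∀ h, 0 ≤ κ h) → (∀ h, κ h ≤ 1) →
      ∫⁻ h, ‖(κ h : ℂ) * (f h - f h * θ h)‖ₑ ∂mH ≤
        ENNReal.ofReal (‖mT‖ / (‖J 1‖ * ∫ t, φ t ∂mG) * ε) := by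
    intro κ hκn hκle
    let p : C_c(H, ℂ) := ⟨⟨fun h => (κ h : ℂ) * (f h - f h * θ h), by fun_prop⟩,
      κ.toComplex.hasCompactSupport.mul_right⟩
    have hp : ∀ h, p h = (κ h : ℂ) * (f h - f h * θ h) := fun _ => rfl
    have hpi : Integrable p mH :=
      (map_continuous p).integrable_of_hasCompactSupport p.hasCompactSupport
    set F := S.cosetSumMap (φ.toComplex.tensor p.normC) with hF
    have hN : ‖(J : C(C(S.Torus, ℂ), ℂ)).comp (S.shift F)‖ ≤ ε := by
      refine (ContinuousMap.norm_le _ hε).2 fun ξ => ?_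
      obtain ⟨x, rfl⟩ := QuotientAddGroup.mk_surjective ξ
      have h1 : (J : C(C(S.Torus, ℂ), ℂ)).comp (S.shift F) (QuotientAddGroup.mk x) =
          ρ.abs.integral fun y => φ.toComplex.tensor p.normC (y + x) :=
        (hJ.integral_add_right _ x).symm
      rw [h1, ← ENNReal.ofReal_le_ofReal_iff hε, ofReal_norm]
      refine ((ρ.abs.enorm_integral_le _).trans (lintegral_mono fun y => ?_)).trans
        (htight x.1 x.2)
      simp only [tensor_apply, normC_apply, Prod.fst_add, Prod.snd_add, enorm_mul]
      rw [mul_assoc]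
      gcongr
      generalize y.2 + x.2 = h
      have : ‖((‖p h‖ : ℝ) : ℂ)‖ₑ = ‖p h‖ₑ := by simp [← ofReal_norm]
      rw [this, hp]
      by_cases hh : h ∈ Q
      · simp [hθ1 h hh]
      · rw [indicator_of_mem (show h ∈ Qᶜ from hh), Pi.one_apply, mul_one, ← ofReal_norm,
          ← ofReal_norm]
        refine ENNReal.ofReal_le_ofReal ?_
        have e : (κ h : ℂ) * (f h - f h * θ h) = ((κ h * (1 - θ h) : ℝ) : ℂ) * f h := by
          push_cast; ring
        rw [e, norm_mul, Complex.norm_real, Real.norm_of_nonneg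
          (mul_nonneg (hκn h) (sub_nonneg.2 (hθle h)))]
        refine mul_le_of_le_one_left (norm_nonneg _) ?_
        exact mul_le_one₀ (hκle h) (sub_nonneg.2 (hθle h)) (by linarith [hθn h])
    -- The function `ξ ↦ J (F (· + ξ))` is at most `ε` in norm by admissibility, while its Haar
    -- integral is `J 1 · ∫ φ · ∫ ‖p‖`.
    have h2 := CutProjectScheme.haar_average hmT F J
    rw [hF, ← hmT, prodFunctional_tensor] at h2
    have h3 : ∫ t, φ.toComplex t ∂mG = ((∫ t, φ t ∂mG : ℝ) : ℂ) := integral_complex_ofReal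
    have h4 : ∫ h, p.normC h ∂mH = ((∫ h, ‖p h‖ ∂mH : ℝ) : ℂ) := integral_complex_ofReal
    have h5 : ‖J 1‖ * ((∫ t, φ t ∂mG) * ∫ h, ‖p h‖ ∂mH) ≤ ‖mT‖ * ε := by
      have h6 := (mT.le_opNorm ((J : C(C(S.Torus, ℂ), ℂ)).comp (S.shift F))).trans
        (mul_le_mul_of_nonneg_left hN (norm_nonneg _))
      rwa [h2, h3, h4, norm_mul, norm_mul, Complex.norm_real, Complex.norm_real,
        Real.norm_of_nonneg hφI.le,
        Real.norm_of_nonneg (integral_nonneg fun _ => norm_nonneg _)] at h6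
    have hJ1' : 0 < ‖J 1‖ := norm_pos_iff.2 hJ1
    calc _ = ENNReal.ofReal (∫ h, ‖p h‖ ∂mH) :=
          (ofReal_integral_norm_eq_lintegral_enorm hpi).symm
      _ ≤ _ := by
          refine ENNReal.ofReal_le_ofReal ?_
          rw [div_mul_eq_mul_div, le_div_iff₀ (by positivity)]
          linarith
  rw [← setLIntegral_univ, ← iUnion_compactCovering H,
    setLIntegral_iUnion_of_directed _ (directed_of_isDirected_le (compactCovering_subset H))]
  refine iSup_le fun n => ?_
  obtain ⟨κ, hκ1, -, hκn, hκle⟩ := exists_cutoff (isCompact_compactCovering H n) isOpen_univ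
    (subset_univ _)
  refine le_trans ?_ (key κ hκn hκle)
  refine le_trans (le_of_eq ?_) (setLIntegral_le_lintegral (compactCovering H n) _)
  refine setLIntegral_congr_fun (isCompact_compactCovering H n).measurableSet fun h hh => ?_
  simp [hκ1 h hh]

theorem lintegral_muIntegrand_tail_le {K : Set G} (hK : IsCompact K) (hK0 : mG K ≠ 0)
    {f : H → ℂ} (hf : Measurable f) {φ : C_c(G, ℝ)} (hφ1 : ∀ t ∈ K - K, φ t = 1)
    {Q : Set H} (hQ : IsCompact Q) {M : ENNReal}
    (htight : ∀ (s : G) (k : H), ∫⁻ y, ‖φ.toComplex (y.1 + s) * f (y.2 + k)‖ₑ *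
      Qᶜ.indicator 1 (y.2 + k) ∂ρ.variation ≤ M)
    {θ : C_c(H, ℝ)} (hθ1 : ∀ h ∈ Q, θ h = 1) (hθn : ∀ h, 0 ≤ θ h) (hθle : ∀ h, θ h ≤ 1)
    {A : Set G} (hA : mG (A + K) ≠ ⊤) (x : G × H) :
    (∫⁻ y, ‖muIntegrand f A x y - muIntegrand (fun h => f h * θ h) A x y‖ₑ ∂ρ.variation) * mG K ≤
      M * mG (A + K) := by
  have h := lintegral_strip_le mG hK hK0 (v := ρ.variation) (φ := fun t => ‖φ.toComplex t‖ₑ)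
    (q := fun h => ‖f h‖ₑ * Qᶜ.indicator 1 h) (M := M)
    (map_continuous φ.toComplex).measurable.enorm (fun t ht => by simp [hφ1 t ht])
    (hf.enorm.mul (measurable_one.indicator hQ.measurableSet.compl))
    (fun x => by simpa only [enorm_mul, mul_assoc] using htight x.1 x.2) hA x
  refine le_trans ?_ h
  gcongr with y
  have e : muIntegrand f A x y - muIntegrand (fun h => f h * θ h) A x y =
      muIntegrand (fun h => f h - f h * θ h) A x y := by
    simp only [muIntegrand]; ring
  rw [e, enorm_muIntegrand]
  gcongr
  generalize y.2 + x.2 = h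
  by_cases hh : h ∈ Q
  · simp [hθ1 h hh]
  · rw [indicator_of_mem (show h ∈ Qᶜ from hh), Pi.one_apply, mul_one, ← ofReal_norm,
      ← ofReal_norm]
    refine ENNReal.ofReal_le_ofReal ?_
    have e : f h - f h * θ h = ((1 - θ h : ℝ) : ℂ) * f h := by push_cast; ring
    rw [e, norm_mul, Complex.norm_real, Real.norm_of_nonneg (sub_nonneg.2 (hθle h))]
    exact mul_le_of_le_one_left (norm_nonneg _) (by linarith [hθn h])

/-- One truncation `f θ` is close to `f` both in `L¹(m_H)` and in `|ρ|`-mean over strips. The first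
needs `J 1 ≠ 0`, that is, `ρ ≠ 0`. -/
theorem IsAdmissible.integrable_and_weylConvergence (hρ : ρ.IsInvariant S.lattice)
    (hρT : S.IsDisintegration (fun g => ρ.integral g) ρT)
    (hmT : S.IsDisintegration (prodFunctional mG mH) mT) (h0 : ρ.variation ≠ 0)
    {f : H → ℂ} (hf : Continuous f) (hfa : IsAdmissible ρ f) :
    Integrable f mH ∧ WeylConvergence mG S ρ f (ρT 1 / mT 1 * ∫ h, f h ∂mH) := by
  obtain ⟨J, hJ, -⟩ := CutProjectScheme.existsUnique_radon hρ.abs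
  have hJ1 := hJ.abs_one_ne_zero h0
  obtain ⟨K, hK, hKn, -⟩ := exists_symm_compact_nhds_zero (G := G)
  have hK0 : (0 : G) ∈ K := mem_of_mem_nhds hKn
  have hmK : mG K ≠ 0 := (Measure.measure_pos_of_mem_nhds mG hKn).ne'
  have hKK : IsCompact (K - K) := by
    rw [sub_eq_add_neg]
    exact hK.add hK.neg
  obtain ⟨φ, hφ1, -, hφn, -⟩ := exists_cutoff hKK isOpen_univ (subset_univ _)
  have hφI : 0 < ∫ t, φ t ∂mG :=
    (map_continuous φ).integral_pos_of_hasCompactSupport_nonneg_nonzero φ.hasCompactSupport hφn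
      (x := 0) (by rw [hφ1 0 ⟨0, hK0, 0, hK0, by simp⟩]; exact one_ne_zero)
  set C₀ : ℝ := ‖mT‖ / (‖J 1‖ * ∫ t, φ t ∂mG) with hC₀
  have hC₀n : 0 ≤ C₀ := by positivity
  have happrox : ∀ ε : ℝ, 0 < ε → ∃ p : C_c(H, ℂ),
      ∫⁻ h, ‖f h - p h‖ₑ ∂mH ≤ ENNReal.ofReal (C₀ * ε) ∧
      ∀ A : Set G, mG (A + K) ≠ ⊤ → ∀ x,
        (∫⁻ y, ‖muIntegrand f A x y - muIntegrand p A x y‖ₑ ∂ρ.variation) * mG K ≤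
          ENNReal.ofReal ε * mG (A + K) := by
    intro ε hε
    obtain ⟨Q, hQ, htight⟩ := hfa.tight ε hε φ.toComplex
    obtain ⟨θ, hθ1, -, hθn, hθle⟩ := exists_cutoff hQ isOpen_univ (subset_univ _)
    exact ⟨cmul ⟨f, hf⟩ θ.toComplex,
      lintegral_tail_le hJ hJ1 hmT hf hφI hε.le htight hθ1 hθn hθle,
      fun A hA x => lintegral_muIntegrand_tail_le hK hmK hf.measurable hφ1 hQ htight hθ1 hθn hθle
        hA x⟩
  have hdiff : ∀ p : C_c(H, ℂ), ∀ {a : ℝ}, ∫⁻ h, ‖f h - p h‖ₑ ∂mH ≤ ENNReal.ofReal a →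
      Integrable (fun h => f h - p h) mH := fun p a ha =>
    ⟨(hf.sub (map_continuous p)).measurable.aestronglyMeasurable, ha.trans_lt ENNReal.ofReal_lt_top⟩
  have hpint : ∀ p : C_c(H, ℂ), Integrable p mH := fun p =>
    (map_continuous p).integrable_of_hasCompactSupport p.hasCompactSupport
  have hfint : Integrable f mH := by
    obtain ⟨p, hp, -⟩ := happrox 1 one_pos
    exact ((hdiff p hp).add (hpint p)).congr (ae_of_all _ fun h => by simp)
  refine ⟨hfint, weylConvergence_of_approx hρ hρT hmT (fun B hB n x => ?_) fun B hB ε hε => ?_⟩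
  · obtain ⟨p, -, hp⟩ := happrox 1 one_pos
    have hfin := hB.measure_add_ne_top hK n
    have hm : AEStronglyMeasurable[borel (G × H)] (muIntegrand f (B n) x) ρ.variation :=
      aestronglyMeasurable_muIntegrand (hB.measurableSet n)
        (aestronglyMeasurable_snd_add hf.measurable _)
    have hpi := integrable_muIntegrand hρ hB p n x
    have hd : Integrable (fun y => muIntegrand f (B n) x y - muIntegrand p (B n) x y)
        ρ.variation := by
      refine ⟨hm.sub hpi.aestronglyMeasurable, ?_⟩
      have := ENNReal.le_div_iff_mul_le (Or.inl hmK) (Or.inl hK.measure_ne_top) |>.2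
        (hp _ hfin x)
      exact this.trans_lt (ENNReal.div_lt_top (ENNReal.mul_ne_top ENNReal.ofReal_ne_top hfin) hmK)
    refine (hd.add hpi).congr (ae_of_all _ fun y => ?_)
    simp
  · have hmKr : 0 < mG.real K := ENNReal.toReal_pos hmK hK.measure_ne_top
    -- The factor `2` comes from `m_G(B n + K) ≤ 2 m_G(B n)`, and `m_G(K)` from the covering
    -- estimate.
    obtain ⟨η, hη, hη1, hη2⟩ : ∃ η : ℝ, 0 < η ∧ C₀ * η ≤ ε ∧ η * 2 ≤ ε * mG.real K := by
      refine ⟨min (ε / (C₀ + 1)) (ε * mG.real K / 2), by positivity, ?_, ?_⟩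
      · calc C₀ * min (ε / (C₀ + 1)) (ε * mG.real K / 2) ≤ (C₀ + 1) * (ε / (C₀ + 1)) := by
              gcongr
              · linarith
              · exact min_le_left _ _
          _ = ε := by field_simp
      · have := min_le_right (ε / (C₀ + 1)) (ε * mG.real K / 2)
        linarith
    obtain ⟨p, hp1, hp2⟩ := happrox η hη
    refine ⟨p, ?_, ?_⟩
    · rw [← norm_neg, neg_sub, ← integral_sub hfint (hpint p),
        ← ENNReal.ofReal_le_ofReal_iff hε.le, ofReal_norm]
      exact (enorm_integral_le_lintegral_enorm _).trans
        (hp1.trans (ENNReal.ofReal_le_ofReal hη1))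
    · filter_upwards [hB.eventually_add_le hK one_ne_zero] with n hn x
      have hfin := hB.measure_add_ne_top hK n
      rw [← ENNReal.mul_le_mul_iff_left hmK hK.measure_ne_top]
      calc _ ≤ ENNReal.ofReal η * mG (B n + K) := hp2 _ hfin x
        _ ≤ ENNReal.ofReal η * (2 * mG (B n)) := by
            rw [one_add_one_eq_two] at hn
            gcongr
        _ = ENNReal.ofReal (η * 2) * mG (B n) := by
            rw [ENNReal.ofReal_mul hη.le, ENNReal.ofReal_ofNat, mul_assoc]
        _ ≤ ENNReal.ofReal (ε * mG.real K) * mG (B n) := by gcongr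
        _ = _ := by
            rw [ENNReal.ofReal_mul hε.le, ofReal_measureReal hK.measure_ne_top]
            ring

end Admissible

/-! ### Riemann integrable functions -/

section Riemann

variable {H : Type*} [TopologicalSpace H] [T2Space H]
  [MeasurableSpace H] [BorelSpace H] {mH : Measure H} [IsFiniteMeasureOnCompacts mH]

/-- Along `ε = 1 / (n + 1)` the infimum of `ψ n - φ n` has integral `0`, so `f` is almost everywhere
the supremum of the `φ n`; this gives measurability, and `φ 0`, `ψ 0` give the bound. -/
theorem IsRiemannIntegrable.integrable {f : H → ℝ}
    (hf : IsRiemannIntegrable mH f) : Integrable f mH := by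
  have hcc : ∀ p : C_c(H, ℝ), Integrable p mH := fun p =>
    (map_continuous p).integrable_of_hasCompactSupport p.hasCompactSupport
  choose φ ψ hle hint using fun n : ℕ => hf (1 / (n + 1)) Nat.one_div_pos_of_nat
  have hd : ∀ᵐ h ∂mH, ⨅ n, ENNReal.ofReal (ψ n h - φ n h) = 0 := by
    have hmeas : Measurable fun h => ⨅ n, ENNReal.ofReal (ψ n h - φ n h) :=
      Measurable.iInf fun n =>
        ((map_continuous (ψ n)).sub (map_continuous (φ n))).measurable.ennreal_ofReal
    refine (lintegral_eq_zero_iff hmeas).1 (le_antisymm ?_ zero_le)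
    have hlim := ENNReal.tendsto_ofReal (tendsto_one_div_add_atTop_nhds_zero_nat (𝕜 := ℝ))
    rw [ENNReal.ofReal_zero] at hlim
    refine ge_of_tendsto' hlim fun n => (lintegral_mono fun h => iInf_le _ n).trans ?_
    have h1 := ofReal_integral_eq_lintegral_ofReal ((hcc (ψ n)).sub (hcc (φ n)))
      (ae_of_all _ fun h => sub_nonneg.2 ((hle n h).1.trans (hle n h).2))
    exact h1.symm.le.trans (ENNReal.ofReal_le_ofReal (hint n))
  have hae : f =ᵐ[mH] fun h => ⨆ n, φ n h := by
    filter_upwards [hd] with h hh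
    have hbdd : BddAbove (range fun n => φ n h) := ⟨f h, by rintro _ ⟨n, rfl⟩; exact (hle n h).1⟩
    refine le_antisymm (le_of_forall_pos_le_add fun ε hε => ?_) (ciSup_le fun n => (hle n h).1)
    obtain ⟨n, hn⟩ := iInf_lt_iff.1 (hh ▸ ENNReal.ofReal_pos.2 hε :
      ⨅ n, ENNReal.ofReal (ψ n h - φ n h) < ENNReal.ofReal ε)
    have h1 := (ENNReal.ofReal_lt_ofReal_iff hε).1 hn
    have h2 := le_ciSup hbdd n
    linarith [(hle n h).2]
  have hm : AEStronglyMeasurable f mH :=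
    ((Measurable.iSup fun n => (map_continuous (φ n)).measurable).aestronglyMeasurable).congr
      hae.symm
  refine Integrable.mono' ((hcc (φ 0)).norm.add (hcc (ψ 0)).norm) hm (ae_of_all _ fun h => ?_)
  have h1 := (hle 0 h).1
  have h2 := (hle 0 h).2
  simp only [Pi.add_apply, Real.norm_eq_abs]
  rcases abs_cases (f h) with h | h <;> rcases abs_cases (φ 0 _) with h' | h' <;>
    rcases abs_cases (ψ 0 _) with h'' | h'' <;> linarith

end Riemann

section RiemannWeyl

variable {G H : Type*} [AddCommGroup G] [TopologicalSpace G] [IsTopologicalAddGroup G]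
  [LocallyCompactSpace G] [SigmaCompactSpace G] [T2Space G] [MeasurableSpace G] [BorelSpace G]
  [AddCommGroup H] [TopologicalSpace H] [IsTopologicalAddGroup H]
  [LocallyCompactSpace H] [SigmaCompactSpace H] [T2Space H] [MeasurableSpace H] [BorelSpace H]
  {S : CutProjectScheme G H} {ρ : ComplexRadonMeasure (G × H)}
  {mG : Measure G} [mG.IsAddHaarMeasure] {mH : Measure H} [mH.IsAddHaarMeasure]
  {ρT mT : C(S.Torus, ℂ) →L[ℂ] ℂ}

theorem ComplexRadonMeasure.IsPositive.integral_ofReal_nonneg (hpos : ρ.IsPositive)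
    {F : G × H → ℂ} (hF : ∀ y, F y = (‖F y‖ : ℂ)) :
    ρ.integral F = ((∫ y, ‖F y‖ ∂ρ.variation : ℝ) : ℂ) := by
  rw [← ρ.integral_variation_ofReal]
  refine integral_congr_ae ?_
  filter_upwards [hpos] with y hy
  rw [hy, mul_one]
  exact hF y

/-- With `d = ψ - φ` one has `|f - φ| ≤ d`. Since `ρ ≥ 0`, the `|ρ|`-mean of `d` over a strip equals
its `ρ`-mean, which the `C_c(H)` case shows to be close to the small number `q ∫ d`. -/
theorem IsRiemannIntegrable.weylConvergence (hρ : ρ.IsInvariant S.lattice)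
    (hρT : S.IsDisintegration (fun g => ρ.integral g) ρT)
    (hmT : S.IsDisintegration (prodFunctional mG mH) mT) (hpos : ρ.IsPositive)
    {f : H → ℝ} (hf : IsRiemannIntegrable mH f)
    (hmeas : ∀ k : H, @AEMeasurable (G × H) ℝ _ (borel (G × H))
      (fun x => f (x.2 + k)) ρ.variation) :
    WeylConvergence mG S ρ (fun h => (f h : ℂ)) (ρT 1 / mT 1 * (∫ h, f h ∂mH : ℝ)) := by
  have hcc : ∀ p : C_c(H, ℝ), Integrable p mH := fun p =>
    (map_continuous p).integrable_of_hasCompactSupport p.hasCompactSupport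
  refine weylConvergence_of_approx hρ hρT hmT (fun B hB n x => ?_) fun B hB ε hε => ?_
  · obtain ⟨φ, ψ, hle, -⟩ := hf 1 one_pos
    refine Integrable.mono' ((integrable_muIntegrand hρ hB φ.toComplex n x).norm.add
      (integrable_muIntegrand hρ hB ψ.toComplex n x).norm)
      (aestronglyMeasurable_muIntegrand (hB.measurableSet n)
        (Complex.measurable_ofReal.comp_aemeasurable (hmeas x.2)).aestronglyMeasurable)
      (ae_of_all _ fun y => ?_)
    simp only [Pi.add_apply, muIntegrand, norm_mul, toComplex_apply, Complex.norm_real,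
      Real.norm_eq_abs]
    rw [← add_mul]
    gcongr
    have h1 := (hle (y.2 + x.2)).1
    have h2 := (hle (y.2 + x.2)).2
    rcases abs_cases (f (y.2 + x.2)) with h | h <;>
      rcases abs_cases (φ (y.2 + x.2)) with h' | h' <;>
      rcases abs_cases (ψ (y.2 + x.2)) with h'' | h'' <;> linarith
  · set q : ℂ := ρT 1 / mT 1 with hq
    obtain ⟨η, hη, hη1, hη2⟩ : ∃ η : ℝ, 0 < η ∧ η ≤ ε ∧ η + ‖q‖ * η ≤ ε := by
      refine ⟨ε / (1 + ‖q‖), by positivity, div_le_self hε.le (by linarith [norm_nonneg q]), ?_⟩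
      refine le_of_eq ?_
      field_simp
    obtain ⟨φ, ψ, hle, hint⟩ := hf η hη
    refine ⟨φ.toComplex, ?_, ?_⟩
    · have h1 : ∫ h, φ.toComplex h ∂mH = ((∫ h, φ h ∂mH : ℝ) : ℂ) := integral_complex_ofReal
      rw [h1, ← Complex.ofReal_sub, Complex.norm_real, ← integral_sub (hcc φ) hf.integrable]
      refine le_trans ?_ (hint.trans hη1)
      refine norm_integral_le_of_norm_le ((hcc ψ).sub (hcc φ)) (ae_of_all _ fun h => ?_)
      rw [Real.norm_eq_abs, abs_le]
      constructor <;> linarith [(hle h).1, (hle h).2]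
    · set d : C_c(H, ℝ) := ψ - φ with hd
      have hd' : ∀ h, d h = ψ h - φ h := fun h => rfl
      have hd0 : ∀ h, 0 ≤ d h := fun h => sub_nonneg.2 ((hle h).1.trans (hle h).2)
      filter_upwards [eventually_norm_integral_sub_le hρ hρT hmT hB d.toComplex hη] with n hn x
      set m : ℝ := mG.real (B n) with hm
      have hm0 : 0 ≤ m := measureReal_nonneg
      have hdI : ‖∫ h, d.toComplex h ∂mH‖ ≤ η := by
        have h1 : ∫ h, d.toComplex h ∂mH = ((∫ h, d h ∂mH : ℝ) : ℂ) := integral_complex_ofReal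
        rw [h1, Complex.norm_real, Real.norm_of_nonneg (integral_nonneg hd0)]
        exact hint
      have h2 : ‖ρ.integral (muIntegrand d.toComplex (B n) x)‖ ≤ ε * m := by
        have h3 := norm_le_norm_sub_add (ρ.integral (muIntegrand d.toComplex (B n) x))
          ((m : ℂ) * (q * ∫ h, d.toComplex h ∂mH))
        calc _ ≤ η * m + m * (‖q‖ * η) := by
              refine h3.trans (add_le_add (hn x) ?_)
              rw [norm_mul, norm_mul, Complex.norm_real, Real.norm_of_nonneg hm0]
              gcongr
          _ = (η + ‖q‖ * η) * m := by ring
          _ ≤ ε * m := by gcongr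
      rw [hpos.integral_ofReal_nonneg (fun y => ?_), Complex.norm_real,
        Real.norm_of_nonneg (integral_nonneg fun _ => norm_nonneg _)] at h2
      · calc _ ≤ ∫⁻ y, ‖muIntegrand d.toComplex (B n) x y‖ₑ ∂ρ.variation := by
              refine lintegral_mono fun y => ?_
              have e : muIntegrand (fun h => (f h : ℂ)) (B n) x y -
                  muIntegrand φ.toComplex (B n) x y =
                  muIntegrand (fun h => ((f h - φ h : ℝ) : ℂ)) (B n) x y := by
                simp only [muIntegrand, toComplex_apply]
                push_cast
                ring
              simp only [e, enorm_muIntegrand]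
              gcongr
              rw [← ofReal_norm, ← ofReal_norm, toComplex_apply, Complex.norm_real,
                Complex.norm_real, Real.norm_of_nonneg (hd0 _),
                Real.norm_of_nonneg (sub_nonneg.2 (hle _).1)]
              refine ENNReal.ofReal_le_ofReal ?_
              rw [hd']
              linarith [(hle (y.2 + x.2)).2]
          _ = ENNReal.ofReal (∫ y, ‖muIntegrand d.toComplex (B n) x y‖ ∂ρ.variation) :=
              (ofReal_integral_norm_eq_lintegral_enorm
                (integrable_muIntegrand hρ hB d.toComplex n x)).symm
          _ ≤ ENNReal.ofReal (ε * m) := ENNReal.ofReal_le_ofReal h2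
          _ = _ := by rw [ENNReal.ofReal_mul hε.le, ofReal_measureReal (hB.measure_ne_top n)]
      · by_cases hy : y.1 + x.1 ∈ B n
        · simp [muIntegrand, hy, abs_of_nonneg (hd0 _)]
        · simp [muIntegrand, hy]

end RiemannWeyl

theorem mainTheorem5 {G H : Type*}
    [AddCommGroup G] [TopologicalSpace G] [IsTopologicalAddGroup G] [LocallyCompactSpace G]
    [SigmaCompactSpace G] [T2Space G] [MeasurableSpace G] [BorelSpace G]
    [AddCommGroup H] [TopologicalSpace H] [IsTopologicalAddGroup H] [LocallyCompactSpace H]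
    [SigmaCompactSpace H] [T2Space H] [MeasurableSpace H] [BorelSpace H]
    (mG : Measure G) [mG.IsAddHaarMeasure] [mG.Regular]
    (mH : Measure H) [mH.IsAddHaarMeasure] [mH.Regular]
    (S : CutProjectScheme G H) (ρ : ComplexRadonMeasure (G × H))
    (hρ : ρ.IsInvariant S.lattice) :
    (∃! ρT : C(S.Torus, ℂ) →L[ℂ] ℂ, S.IsDisintegration (fun g => ρ.integral g) ρT) ∧
    (∃! mT : C(S.Torus, ℂ) →L[ℂ] ℂ, S.IsDisintegration (prodFunctional mG mH) mT) ∧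
    ∀ ρT mT : C(S.Torus, ℂ) →L[ℂ] ℂ,
      S.IsDisintegration (fun g => ρ.integral g) ρT →
      S.IsDisintegration (prodFunctional mG mH) mT →
      mT 1 ≠ 0 ∧
      (∀ f : C_c(H, ℂ),
        WeylConvergence mG S ρ f (ρT 1 / mT 1 * ∫ h, f h ∂mH)) ∧
      (∀ f : H → ℂ, Continuous f → IsAdmissible ρ f →
        (ρ.variation ≠ 0 → Integrable f mH) ∧
        WeylConvergence mG S ρ f (ρT 1 / mT 1 * ∫ h, f h ∂mH)) ∧
      (ρ.IsPositive → ∀ f : H → ℝ, IsRiemannIntegrable mH f →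
        (∀ k : H, @AEMeasurable (G × H) ℝ _ (borel (G × H))
          (fun x => f (x.2 + k)) ρ.variation) →
        Integrable f mH ∧
        WeylConvergence mG S ρ (fun h => (f h : ℂ)) (ρT 1 / mT 1 * ∫ h, f h ∂mH)) := by

  refine ⟨CutProjectScheme.existsUnique_radon hρ, S.existsUnique_prodFunctional mG mH,
    fun ρT mT hρT hmT => ⟨CutProjectScheme.haar_one_ne_zero hmT, weylConvergence_cc hρ hρT hmT,
      fun f hf hfa => ?_, fun hpos f hf hmeas =>
      ⟨hf.integrable, hf.weylConvergence hρ hρT hmT hpos hmeas⟩⟩⟩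
  by_cases h0 : ρ.variation = 0
  · exact ⟨fun h => absurd h0 h, weylConvergence_of_variation_eq_zero h0 hρT f _⟩
  · have h := hfa.integrable_and_weylConvergence hρ hρT hmT h0 hf
    exact ⟨fun _ => h.1, h.2⟩
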